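/- **Traces.** Fix finite sets of threads, locks and variables with at least $3$, $4$ and $2$ elements respectively. An event is one of the operations $\mathtt{acq}(\ell)$, $\mathtt{rel}(\ell)$, $\mathtt{r}(x)$, $\mathtt{w}(x)$ ($\ell$ a lock, $x$ a variable) performed by a thread. For a finite sequence $\sigma$ of events, $<_{tr}$ is the order of occurrence in $\sigma$; $e<_{TO}e'$ means that $e<_{tr}e'$ and both are performed by the same thread; $\le_{TO}$ is its reflexive closure. For an acquire $a$ of $\ell$, $\mathrm{match}(a)$ is the earliest release $r$ of $\ell$ with $a<_{TO}r$ (if any); the critical section of $a$ over $\ell$ consists of all events $e$ with $a\le_{TO}e$ and, if $r=\mathrm{match}(a)$ exists, $e\le_{TO}r$; it is also denoted $\mathrm{CS}(r)$. The sequence $\sigma$ is a *trace* if (1) for any two acquires $a_1<_{tr}a_2$ of the same lock, $\mathrm{match}(a_1)$ exists and $\mathrm{match}(a_1)<_{tr}a_2$; (2) every acquire contained in a critical section $C$ has its match in $C$; (3) every release is the match of an acquire. Two events conflict, $e\asymp e'$, if they access the same variable, at least one of them is a write, and they are performed by different threads. Let $\le_{HB}$ be the smallest partial order on the events of $\sigma$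 that contains $<_{TO}$ and orders every release before all $<_{tr}$-later acquires of the same lock. Let $\prec_{WCP}$ be the smallest relation such that: (a) if $r$ is a release of $\ell$, $e$ is a read/write event in a critical section over $\ell$, $r<_{tr}e$, and some $e'\in\mathrm{CS}(r)$ conflicts with $e$, then $r\prec_{WCP}e$; (b) if $r_1<_{tr}r_2$ are releases of the same lock and $e_1\prec_{WCP}e_2$ for some $e_1\in\mathrm{CS}(r_1)$, $e_2\in\mathrm{CS}(r_2)$, then $r_1\prec_{WCP}r_2$; (c) $\prec_{WCP}$ is closed under composition with $\le_{HB}$ on the left and on the right. The *WCP relation* is $\le_{WCP}\;=\;\prec_{WCP}\cup\le_{TO}$. **Algorithms.** An algorithm is a deterministic Turing machine with a two-way read-only input tape and one or more read-write work tapes. It *computes the WCP relation* if for every trace $\sigma$ and every two events $e_1,e_2$ of $\sigma$ it halts on the input $(\sigma,e_1,e_2)$ and accepts if and only if $e_1\le_{WCP}e_2$. The input is the sequence of the events of $\sigma$, with $e_1$ and $e_2$ marked, every marked or unmarked event being written as a nonempty string over the machine's input alphabet, by any fixed encoding. The algorithm takes time $T(n)$ and space $S(n)$ if on all such inputs, where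 $\sigma$ has $n$ events, it makes at most $T(n)$ steps and visits at most $S(n)$ cells on its work tapes, the initially scanned cells included. **Theorem.** For any algorithm that computes the WCP relation in time $T(n)$ and space $S(n)$, it is the case that $T(n)\cdot S(n)\in\Omega(n^2)$, that is, there is a constant $c>0$ such that $T(n)\,S(n)\ge c\,n^2$ for all sufficiently large $n$. -/

import Mathlib

/-! ### Traces of concurrent programs and the weak-causal-precedence relation -/

namespace Trace

/-- The operations a thread can perform: acquiring or releasing a lock, reading or writing a
variable. -/
inductive Op (Lck Var : Type*) where
  | acq (l : Lck)
  | rel (l : Lck)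
  | read (x : Var)
  | write (x : Var)

/-- An event is an operation together with the thread performing it. -/
structure Event (Thr Lck Var : Type*) where
  thread : Thr
  op : Op Lck Var

section Relations

variable {Thr Lck Var : Type*} (σ : List (Event Thr Lck Var))

/-- The events of the sequence `σ` are its positions; `thr σ i` is the thread of the event at
position `i`. The order `<_tr` is the order `<` of positions. -/
def thr (i : Fin σ.length) : Thr := (σ.get i).thread

/-- The operation of the event at position `i`. -/
def op (i : Fin σ.length) : Op Lck Var := (σ.get i).op

/-- Strict thread order `<_TO`. -/
def ThreadLT (i j : Fin σ.length) : Prop := i < j ∧ thr σ i = thr σ j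

/-- Thread order `≤_TO`. -/
def ThreadLE (i j : Fin σ.length) : Prop := ThreadLT σ i j ∨ i = j

/-- `r = match(a)` : `a` is an acquire and `r` is the earliest release of the same lock that is
thread ordered after `a`. (In a trace, as defined below, it is equivalent to say that `a` is the
latest acquire of that lock that is thread ordered before the release `r`.) -/
def Match (a r : Fin σ.length) : Prop :=
  ∃ l, op σ a = .acq l ∧ op σ r = .rel l ∧ ThreadLT σ a r ∧
    ∀ r', op σ r' = .rel l → ThreadLT σ a r' → r ≤ r'

/-- `e` belongs to the critical section that starts at the acquire event `a`: it is an event of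
the thread of `a`, not before `a`, and not after the matching release if there is one. -/
def InCS (a e : Fin σ.length) : Prop :=
  (∃ l, op σ a = .acq l) ∧ ThreadLE σ a e ∧ ∀ r, Match σ a r → e ≤ r

/-- `e ∈ CS(r)` for a release event `r`: `e` is in the critical section that ends at `r`. -/
def InCSRel (r e : Fin σ.length) : Prop := ∃ a, Match σ a r ∧ InCS σ a e

/-- `e ∈ l` : the event `e` is contained in a critical section over the lock `l`. -/
def UnderLock (e : Fin σ.length) (l : Lck) : Prop := ∃ a, op σ a = .acq l ∧ InCS σ a e

/-- A sequence of events is a trace. -/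
structure IsTrace : Prop where
  /-- Between two acquires of one lock there is the match of the first. -/
  lock_semantics : ∀ a₁ a₂ l, op σ a₁ = .acq l → op σ a₂ = .acq l → a₁ < a₂ →
    ∃ r, Match σ a₁ r ∧ r < a₂
  /-- An acquire inside a critical section has its match inside that critical section. -/
  well_nested : ∀ c a l, op σ a = .acq l → InCS σ c a → ∃ r, Match σ a r ∧ InCS σ c r
  /-- Every release is the release of a lock acquired before. -/
  rel_matched : ∀ r l, op σ r = .rel l → ∃ a, Match σ a r

/-- The event at position `i` writes the variable `x`. -/
def Writes (i : Fin σ.length) (x : Var) : Prop := op σ i = .write x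

/-- The event at position `i` reads or writes the variable `x`. -/
def Accesses (i : Fin σ.length) (x : Var) : Prop := op σ i = .read x ∨ op σ i = .write x

/-- Conflicting events: accesses to the same variable by different threads, at least one of
them a write. -/
def Conflict (i j : Fin σ.length) : Prop :=
  ∃ x, Accesses σ i x ∧ Accesses σ j x ∧ (Writes σ i x ∨ Writes σ j x) ∧ thr σ i ≠ thr σ j

/-- Happens-before: the smallest partial order containing thread order and ordering each release
before all later acquires of the same lock. -/
inductive HB : Fin σ.length → Fin σ.length → Prop
  | thread {i j} : ThreadLE σ i j → HB i j
  | lock {r a} (l : Lck) : op σ r = .rel l → op σ a = .acq l → r < a → HB r a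
  | trans {i j k} : HB i j → HB j k → HB i k

/-- Weak-causally-precedes `≺_WCP`: the smallest relation satisfying rules (a), (b) and (c). -/
inductive Prec : Fin σ.length → Fin σ.length → Prop
  /-- Rule (a); that `e` is a read or write event is part of the conflict. -/
  | conflict {r e e'} (l : Lck) : op σ r = .rel l → UnderLock σ e l → r < e →
      InCSRel σ r e' → Conflict σ e e' → Prec r e
  /-- Rule (b). -/
  | release {r₁ r₂ e₁ e₂} (l : Lck) : op σ r₁ = .rel l → op σ r₂ = .rel l → r₁ < r₂ →
      InCSRel σ r₁ e₁ → InCSRel σ r₂ e₂ → Prec e₁ e₂ → Prec r₁ r₂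
  /-- Rule (c), right composition with happens-before. -/
  | comp_hb {i j k} : Prec i j → HB σ j k → Prec i k
  /-- Rule (c), left composition with happens-before. -/
  | hb_comp {i j k} : HB σ i j → Prec j k → Prec i k

/-- The WCP relation `≤_WCP`, the union of `≺_WCP` and `≤_TO`. -/
def WCP (i j : Fin σ.length) : Prop := Prec σ i j ∨ ThreadLE σ i j

/-- The trace `σ` with a queried pair of events marked: every event is accompanied by two bits
telling whether it is the first, respectively the second event of the pair. -/
def query (i j : Fin σ.length) : List (Event Thr Lck Var × Bool × Bool) :=
  List.ofFn fun k => (σ.get k, decide (k = i), decide (k = j))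

end Relations

end Trace

/-! ### Deterministic Turing machines with a read-only input tape -/

namespace OfflineTM

/-- Head movements. -/
inductive Move where
  | left
  | stay
  | right

/-- What the input head can see: one of the two end markers, or a letter of the input. -/
inductive InSym (α : Type*) where
  | leftEnd
  | letter (x : α)
  | rightEnd

/-- A deterministic Turing machine with a two-way read-only input tape over the alphabet `α` and
`tapes ≥ 1` two-way infinite read-write work tapes. It has finitely many states and work
symbols. The transition function yields `none` when the machine halts; otherwise it yields the
next state, the movement of the input head and, for every work tape, the symbol written and the
movement of the head. -/
structure Machine (α : Type*) where
  State : Type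
  Sym : Type
  tapes : ℕ
  [finState : Finite State]
  [finSym : Finite Sym]
  tapes_pos : 0 < tapes
  start : State
  accepting : Set State
  blank : Sym
  δ : State → InSym α → (Fin tapes → Sym) → Option (State × Move × (Fin tapes → Sym × Move))

variable {α : Type*} (M : Machine α)

/-- A configuration. Input head position `0` is the left end marker, position `p + 1` is the
letter with index `p` of the input, and the position after the last letter is the right end
marker. -/
structure Config where
  state : M.State
  inHead : ℕ
  tape : Fin M.tapes → ℤ → M.Sym
  head : Fin M.tapes → ℤ

/-- The symbol at position `p` of the input tape holding `w`. -/
def inputAt (w : List α) : ℕ → InSym α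
  | 0 => .leftEnd
  | p + 1 => match w[p]? with
    | some x => .letter x
    | none => .rightEnd

/-- Moving the input head on an input of length `n`; it never leaves the end markers. -/
def moveIn (n : ℕ) (p : ℕ) : Move → ℕ
  | .left => p - 1
  | .stay => p
  | .right => min (p + 1) (n + 1)

/-- Displacement of a work head. -/
def shift : Move → ℤ
  | .left => -1
  | .stay => 0
  | .right => 1

/-- The initial configuration: all work tapes blank, the input head on the left end marker. -/
def init : Config M where
  state := M.start
  inHead := 0
  tape := fun _ _ => M.blank
  head := fun _ => 0

/-- The action that the machine takes in the configuration `c` on input `w`. -/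
def action (w : List α) (c : Config M) :
    Option (M.State × Move × (Fin M.tapes → M.Sym × Move)) :=
  M.δ c.state (inputAt w c.inHead) fun k => c.tape k (c.head k)

/-- One step on input `w`; a halted configuration stays as it is. -/
def step (w : List α) (c : Config M) : Config M :=
  match action M w c with
  | none => c
  | some (q, d, f) =>
    { state := q
      inHead := moveIn w.length c.inHead d
      tape := fun k => Function.update (c.tape k) (c.head k) (f k).1
      head := fun k => c.head k + shift (f k).2 }

/-- The configuration after `t` steps on input `w`. -/
def run (w : List α) (t : ℕ) : Config M := (step M w)^[t] (init M)

/-- On input `w` the machine halts after at most `t` steps. -/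
def HaltsBy (w : List α) (t : ℕ) : Prop := action M w (run M w t) = none

/-- On input `w` the machine halts in an accepting state. -/
def Accepts (w : List α) : Prop := ∃ t, HaltsBy M w t ∧ (run M w t).state ∈ M.accepting

/-- The number of work tape cells visited in the first `t` steps on input `w`, summed over all
work tapes. -/
def cells (w : List α) (t : ℕ) : ℕ :=
  ∑ k, ((Finset.range (t + 1)).image fun s => (run M w s).head k).card

end OfflineTM

namespace Trace

section Algorithms

variable {Thr Lck Var α : Type*} (enc : Event Thr Lck Var × Bool × Bool → List α)

/-- The input word presenting the trace `σ` and the pair `i`, `j`, where `enc` encodes single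
(marked) events as strings. -/
def input (σ : List (Event Thr Lck Var)) (i j : Fin σ.length) : List α :=
  (query σ i j).flatMap enc

variable (M : OfflineTM.Machine α)

/-- `M` computes the WCP relation: given any trace and any two of its events, it halts and
accepts exactly if the first is WCP-before-or-equal to the second. -/
def ComputesWCP : Prop :=
  ∀ σ : List (Event Thr Lck Var), IsTrace σ → ∀ i j : Fin σ.length,
    (∃ t, OfflineTM.HaltsBy M (input enc σ i j) t) ∧
    (OfflineTM.Accepts M (input enc σ i j) ↔ WCP σ i j)

/-- On traces with `n` events, `M` makes at most `T n` steps. -/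
def RunsInTime (T : ℕ → ℕ) : Prop :=
  ∀ σ : List (Event Thr Lck Var), IsTrace σ → ∀ i j : Fin σ.length,
    OfflineTM.HaltsBy M (input enc σ i j) (T σ.length)

/-- On traces with `n` events, `M` visits at most `S n` cells of its work tapes. -/
def RunsInSpace (S : ℕ → ℕ) : Prop :=
  ∀ σ : List (Event Thr Lck Var), IsTrace σ → ∀ i j : Fin σ.length,
    ∀ t, OfflineTM.cells M (input enc σ i j) t ≤ S σ.length

end Algorithms

end Trace

/-! A crossing-sequence argument on a fooling set. For bit strings `u`, `v` of length `m` there is a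
trace whose left half depends only on `u`, whose right half depends only on `v`, and whose halves
are separated by `d` harmless reads; two fixed events are WCP-ordered exactly if `u = v`
(`Palette.wcp_iff`). Cut the run of a machine at the padding `P`. In each round the input head has
to cross all of `P`, so at most `T / (P.length + 1)` messages are sent, each of them a work tape
configuration of `O(S)` bits. If the inputs for `(u, u)` and `(v, v)` had the same messages, the
input for `(u, v)` would be accepted as well (`accepts_of_message_eq`). Hence `m = O(S * T / d)`
(`exists_mul_le_of_fooling`), and choosing `m` and `d` linear in `n` gives the bound.

In the trace, the sections of `t₁` over the locks `c (u i)` overlap those of `t₀` over `p`, while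
`t₂` passes alternately through `p` and `c (v j)`. The writes of `x` put the first release of `p`
before the first right block by rule (a). From there rule (b) climbs. The acquire of `c (u i)`
happens before the release of `p` in left block `i`, so if the latter precedes the release of `p` in
right block `i` and `u i = v i`, then the releases of `c (u i)` are ordered too. The next section
over `p` opens before that release, so the next releases of `p` are ordered, and so on
(`prec_of_eq`). Conversely, a mismatch wastes a right block, and there are only `m` of them: `bound`
records how far the climb can have come, and `lt_bound_of_prec` shows that no rule exceeds it. The
lock `y` only relays happens-before inside the left half; it is absent from the right half, so rule
(b) gains nothing from it. -/

namespace OfflineTM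

/-! ### Splitting a run between two players -/

section Protocol

variable {α : Type*} {M : Machine α}

/-- The configuration `c` with the input head moved to position `p`. -/
def Config.place (c : Config M) (p : ℕ) : Config M := { c with inHead := p }

/-- The configuration `c` with the input head moved `k` positions to the right. -/
def Config.offset (c : Config M) (k : ℕ) : Config M := c.place (c.inHead + k)

/-- The side conditions say that the head does not look at an end marker of `w` where the longer
word has a letter; an end marker may be read if nothing lies beyond it. -/
theorem inputAt_append (pre w post : List α) (p : ℕ) (h₁ : pre = [] ∨ 1 ≤ p)
    (h₂ : post = [] ∨ p ≤ w.length) :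
    inputAt (pre ++ (w ++ post)) (p + pre.length) = inputAt w p := by
  rcases p with _ | q
  · have : pre = [] := by simpa using h₁
    subst this; rfl
  · have e : q + 1 + pre.length = (q + pre.length) + 1 := by omega
    rw [e]
    simp only [inputAt]
    have : (pre ++ (w ++ post))[q + pre.length]? = w[q]? := by
      rw [List.getElem?_append_right (by omega), Nat.add_sub_cancel]
      rcases h₂ with rfl | h₂
      · simp
      · rw [List.getElem?_append_left (by omega)]
    rw [this]

theorem action_append (pre w post : List α) (c : Config M) (h₁ : pre = [] ∨ 1 ≤ c.inHead)
    (h₂ : post = [] ∨ c.inHead ≤ w.length) :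
    action M (pre ++ (w ++ post)) (c.offset pre.length) = action M w c := by
  simp only [action, Config.offset, Config.place, inputAt_append pre w post _ h₁ h₂]

theorem moveIn_append (pre w post : List α) (p : ℕ) (d : Move) (h₁ : pre = [] ∨ 1 ≤ p)
    (h₂ : post = [] ∨ p ≤ w.length) :
    moveIn (pre ++ (w ++ post)).length (p + pre.length) d = moveIn w.length p d + pre.length := by
  have h₁' : pre.length = 0 ∨ 1 ≤ p := by simpa using h₁
  have h₂' : post.length = 0 ∨ p ≤ w.length := by simpa using h₂
  cases d <;> simp only [moveIn, List.length_append] <;> omega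

theorem step_append (pre w post : List α) (c : Config M) (h₁ : pre = [] ∨ 1 ≤ c.inHead)
    (h₂ : post = [] ∨ c.inHead ≤ w.length) :
    step M (pre ++ (w ++ post)) (c.offset pre.length) = (step M w c).offset pre.length := by
  unfold step
  rw [action_append pre w post c h₁ h₂]
  rcases action M w c with _ | ⟨q, d, f⟩
  · rfl
  · simp only [Config.offset, Config.place, moveIn_append pre w post _ d h₁ h₂]

theorem iterate_step_append (pre w post : List α) (c : Config M) (s : ℕ)
    (h₁ : ∀ r < s, pre = [] ∨ 1 ≤ ((step M w)^[r] c).inHead)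
    (h₂ : ∀ r < s, post = [] ∨ ((step M w)^[r] c).inHead ≤ w.length) :
    (step M (pre ++ (w ++ post)))^[s] (c.offset pre.length) =
      ((step M w)^[s] c).offset pre.length := by
  induction s with
  | zero => rfl
  | succ s ih =>
    rw [Function.iterate_succ_apply', Function.iterate_succ_apply',
      ih (fun r hr => h₁ r (by omega)) (fun r hr => h₂ r (by omega)),
      step_append _ _ _ _ (h₁ s (by omega)) (h₂ s (by omega))]

theorem inHead_step_le (w : List α) (c : Config M) :
    (step M w c).inHead ≤ c.inHead + 1 ∧
      (c.inHead ≤ w.length + 1 → c.inHead ≤ (step M w c).inHead + 1) ∧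
      (c.inHead ≤ w.length + 1 → (step M w c).inHead ≤ w.length + 1) := by
  unfold step
  rcases action M w c with _ | ⟨q, d, f⟩
  · simp
  · cases d <;> simp only [moveIn] <;> omega

theorem inHead_iterate_le (w : List α) (c : Config M) (s : ℕ) :
    ((step M w)^[s] c).inHead ≤ c.inHead + s ∧
      (c.inHead ≤ w.length + 1 → c.inHead ≤ ((step M w)^[s] c).inHead + s) ∧
      (c.inHead ≤ w.length + 1 → ((step M w)^[s] c).inHead ≤ w.length + 1) := by
  induction s with
  | zero => simp
  | succ s ih =>
    rw [Function.iterate_succ_apply']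
    have := inHead_step_le w ((step M w)^[s] c)
    omega

theorem iterate_of_action_eq_none (w : List α) (c : Config M) (h : action M w c = none) (s : ℕ) :
    (step M w)^[s] c = c :=
  Function.iterate_fixed (by simp [step, h]) s

theorem run_add (w : List α) (s t : ℕ) : run M w (t + s) = (step M w)^[s] (run M w t) := by
  rw [add_comm, run, run, Function.iterate_add_apply]

theorem run_eq_of_haltsBy {w : List α} {s t : ℕ} (h : HaltsBy M w s) (hst : s ≤ t) :
    run M w t = run M w s := by
  obtain ⟨k, rfl⟩ := Nat.exists_eq_add_of_le hst
  rw [run_add, iterate_of_action_eq_none _ _ h]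

open Classical in
/-- The machine is started on input `w` in the configuration `c`; the result is the configuration
in which the input head first visits the position `target` (the input head being forgotten). -/
noncomputable def exitConfig (w : List α) (target : ℕ) (c : Config M) : Option (Config M) :=
  if h : ∃ t, ((step M w)^[t] c).inHead = target then some (((step M w)^[Nat.find h] c).place 0)
  else none

theorem exitConfig_eq_some {w : List α} {target : ℕ} {c d : Config M}
    (h : exitConfig w target c = some d) :
    ∃ s, (step M w)^[s] c = d.place target ∧ ∀ r < s, ((step M w)^[r] c).inHead ≠ target := by
  classical
  unfold exitConfig at h
  split_ifs at h with hex
  refine ⟨Nat.find hex, ?_, fun r hr => Nat.find_min hex hr⟩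
  have h1 := Nat.find_spec hex
  rw [Option.some.injEq] at h
  subst h
  generalize (step M w)^[Nat.find hex] c = e at h1
  subst h1
  rfl

theorem exitConfig_eq_none {w : List α} {target : ℕ} {c : Config M}
    (h : exitConfig w target c = none) (s : ℕ) : ((step M w)^[s] c).inHead ≠ target := by
  classical
  unfold exitConfig at h
  split_ifs at h with hex
  exact fun hs => hex ⟨s, hs⟩

/-! The input `X ++ P ++ Y` is split between two players, of which the first one knows `X ++ P`
and the second one `P ++ Y`. The players take turns in running the machine: a player continues
until the input head leaves the part of the input that he knows. -/

variable (X P Y : List α)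

/-- The part of the input known to the player of round `i`. -/
def part (i : ℕ) : List α := if Even i then X ++ P else P ++ Y

/-- The part of the input that precedes the one known to the player of round `i`. -/
def before (i : ℕ) : List α := if Even i then [] else X

/-- The part of the input that follows the one known to the player of round `i`. -/
def after (i : ℕ) : List α := if Even i then Y else []

/-- The position of the input head at the start of round `i`, in the part known to the player. -/
def startPos (i : ℕ) : ℕ := if i = 0 then 0 else if Even i then X.length else P.length + 1

/-- The position of the input head that ends round `i`, in the part known to the player. -/
def stopPos (i : ℕ) : ℕ := if Even i then (X ++ P).length + 1 else 0

/-- The configuration at the start of round `i`, if that round takes place. -/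
noncomputable def message : ℕ → Option (Config M)
  | 0 => some (init M)
  | i + 1 => (message i).bind fun c =>
      exitConfig (part X P Y i) (stopPos X P i) (c.place (startPos X P i))

theorem before_part_after (i : ℕ) : before X i ++ (part X P Y i ++ after Y i) = X ++ (P ++ Y) := by
  unfold before part after
  split_ifs <;> simp

/-- The handover takes place at one absolute position: `X.length + P.length + 1` after an even round
and `X.length` after an odd one, that is, just beyond `P` on either side. -/
theorem startPos_succ (i : ℕ) :
    startPos X P (i + 1) + (before X (i + 1)).length = stopPos X P i + (before X i).length := by
  unfold startPos before stopPos
  by_cases h : Even i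
  · have h' : ¬ Even (i + 1) := by simpa [Nat.even_add_one] using h
    simp [h, h']; omega
  · have h' : Even (i + 1) := by simpa [Nat.even_add_one] using h
    simp [h, h']

variable {X P Y}

/-- Until the stop position is reached, the head sees only what the player knows, so the player's
own simulation agrees with the run on the whole input. -/
theorem iterate_round (i : ℕ) (c : Config M) (s : ℕ)
    (h : ∀ r < s, ((step M (part X P Y i))^[r] (c.place (startPos X P i))).inHead ≠
      stopPos X P i) :
    (step M (X ++ (P ++ Y)))^[s] ((c.place (startPos X P i)).offset (before X i).length) =
      ((step M (part X P Y i))^[s] (c.place (startPos X P i))).offset (before X i).length := by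
  rw [← before_part_after X P Y i]
  apply iterate_step_append
  · intro r hr
    have := h r hr
    unfold before
    unfold stopPos at this
    split_ifs at this ⊢ with he
    · exact Or.inl rfl
    · exact Or.inr (by omega)
  · intro r hr
    have := h r hr
    have h2 := (inHead_iterate_le (part X P Y i) (c.place (startPos X P i)) r).2.2
    have h3 : (c.place (startPos X P i)).inHead = startPos X P i := rfl
    rw [h3] at h2
    generalize ((step M (part X P Y i))^[r] (c.place (startPos X P i))).inHead = a at *
    unfold after
    unfold stopPos at this
    unfold part startPos at *
    split_ifs at this h2 ⊢ with he <;> simp_all <;> omega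

theorem action_round (i : ℕ) (c : Config M) (s : ℕ)
    (h : ∀ r, ((step M (part X P Y i))^[r] (c.place (startPos X P i))).inHead ≠
      stopPos X P i) :
    action M (X ++ (P ++ Y))
      ((step M (X ++ (P ++ Y)))^[s] ((c.place (startPos X P i)).offset (before X i).length)) =
      action M (part X P Y i) ((step M (part X P Y i))^[s] (c.place (startPos X P i))) := by
  rw [iterate_round i c s fun r _ => h r]
  conv_lhs => rw [← before_part_after X P Y i]
  apply action_append
  · have := h s
    unfold before
    unfold stopPos at this
    split_ifs at this ⊢ with he
    · exact Or.inl rfl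
    · exact Or.inr (by omega)
  · have := h s
    have h2 := (inHead_iterate_le (part X P Y i) (c.place (startPos X P i)) s).2.2
    have h3 : (c.place (startPos X P i)).inHead = startPos X P i := rfl
    rw [h3] at h2
    generalize ((step M (part X P Y i))^[s] (c.place (startPos X P i))).inHead = a at *
    unfold after
    unfold stopPos at this
    unfold part startPos at *
    split_ifs at this h2 ⊢ with he <;> simp_all <;> omega

/-- A message is sent after every `P.length + 1` steps at the earliest, and not after the machine
has halted. -/
theorem exists_run_of_message {i : ℕ} {c : Config M} (h : message X P Y i = some c) :
    ∃ t, i * (P.length + 1) ≤ t ∧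
      run M (X ++ (P ++ Y)) t = (c.place (startPos X P i)).offset (before X i).length ∧
      ∀ T, HaltsBy M (X ++ (P ++ Y)) T → t ≤ T := by
  induction i generalizing c with
  | zero =>
    simp only [message, Option.some.injEq] at h
    subst h
    exact ⟨0, by simp, by simp [run, before, startPos, Config.place, Config.offset, init], by simp⟩
  | succ i ih =>
    rw [message, Option.bind_eq_some_iff] at h
    obtain ⟨d, hd, hc⟩ := h
    obtain ⟨t, hit, ht, hT⟩ := ih hd
    obtain ⟨s, hs, hmin⟩ := exitConfig_eq_some hc
    -- Start and stop lie on opposite sides of `P`, and the head moves by at most one position per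
    -- step.
    have hsP : P.length + 1 ≤ s := by
      have h2 := inHead_iterate_le (part X P Y i) (d.place (startPos X P i)) s
      rw [hs] at h2
      simp only [Config.place] at h2
      unfold startPos stopPos part at h2
      split_ifs at h2 <;> simp_all
      omega
    have hrun : run M (X ++ (P ++ Y)) (t + s) =
        (c.place (startPos X P (i + 1))).offset (before X (i + 1)).length := by
      rw [run_add, ht, iterate_round i d s hmin, hs]
      simp only [Config.place, Config.offset, startPos_succ]
    refine ⟨t + s, by rw [add_mul]; omega, hrun, fun T hTT => ?_⟩
    -- Had the machine halted earlier, the head would already be at the stop position after `s - 1`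
    -- steps of the round, against the minimality of `s`; here `s ≥ 1` by `hsP`.
    by_contra hlt
    have h1 := run_eq_of_haltsBy hTT (show T ≤ t + s by omega)
    have h2 := run_eq_of_haltsBy hTT (show T ≤ t + (s - 1) by omega)
    rw [← h2, run_add, ht, iterate_round i d s hmin, hs, run_add, ht,
      iterate_round i d (s - 1) fun r hr => hmin r (by omega)] at h1
    have h3 := congrArg Config.inHead h1
    simp only [Config.offset, Config.place, Nat.add_right_cancel_iff] at h3
    exact hmin (s - 1) (by omega) h3.symm

/-- The player in whose round the machine halts knows whether it accepts. -/
theorem accepts_iff_of_message {i : ℕ} {c : Config M} (h : message X P Y i = some c)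
    (h' : message (M := M) X P Y (i + 1) = none) :
    Accepts M (X ++ (P ++ Y)) ↔
      ∃ s, action M (part X P Y i) ((step M (part X P Y i))^[s] (c.place (startPos X P i))) = none ∧
        ((step M (part X P Y i))^[s] (c.place (startPos X P i))).state ∈ M.accepting := by
  rw [message, h, Option.bind_some] at h'
  have hne := exitConfig_eq_none h'
  obtain ⟨t, -, ht, -⟩ := exists_run_of_message h
  constructor
  · rintro ⟨s, hs, hacc⟩
    have h1 := run_eq_of_haltsBy hs (show s ≤ t + s by omega)
    refine ⟨s, ?_, ?_⟩
    · rw [← action_round i c s hne, ← ht, ← run_add, h1]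
      exact hs
    · rw [← h1, run_add, ht, iterate_round i c s fun r _ => hne r] at hacc
      exact hacc
  · rintro ⟨s, hs, hacc⟩
    refine ⟨t + s, ?_, ?_⟩
    · rw [HaltsBy, run_add, ht, action_round i c s hne]
      exact hs
    · rw [run_add, ht, iterate_round i c s fun r _ => hne r]
      exact hacc

/-- Inputs with the same messages can be crossed. -/
theorem accepts_of_message_eq {X₁ X₂ P Y₁ Y₂ : List α}
    (hmsg : ∀ i, message (M := M) X₁ P Y₁ i = message X₂ P Y₂ i)
    (hhalt : ∃ T, HaltsBy M (X₁ ++ (P ++ Y₁)) T)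
    (h₁ : Accepts M (X₁ ++ (P ++ Y₁))) (h₂ : Accepts M (X₂ ++ (P ++ Y₂))) :
    Accepts M (X₁ ++ (P ++ Y₂)) := by
  classical
  -- Even rounds of the crossed input see `X₁ ++ P` and proceed as for `(X₁, Y₁)`; odd rounds see `P
  -- ++ Y₂` and proceed as for `(X₂, Y₂)`, whose messages are the same.
  have hcross : ∀ i, message (M := M) X₁ P Y₂ i = message X₁ P Y₁ i := by
    intro i
    induction i with
    | zero => rfl
    | succ i ih =>
      by_cases he : Even i
      · simp only [message, ih, part, he, if_true]
      · rw [hmsg, message, message, ih, hmsg]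
        simp only [part, he, if_false, startPos, stopPos]
  have hnone : ∃ i, message (M := M) X₁ P Y₁ i = none := by
    obtain ⟨T, hT⟩ := hhalt
    -- Every round takes at least one step, so round `T + 1` would start after the machine has
    -- halted.
    refine ⟨T + 1, ?_⟩
    by_contra hsome
    obtain ⟨c, hc⟩ := Option.ne_none_iff_exists'.mp hsome
    obtain ⟨t, ht, -, ht'⟩ := exists_run_of_message hc
    have := ht' T hT
    nlinarith [Nat.zero_le (T * P.length), Nat.zero_le P.length]
  have hspec := Nat.find_spec hnone
  have hmin := fun j => Nat.find_min hnone (m := j)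
  rcases hi : Nat.find hnone with _ | i
  · rw [hi] at hspec; simp [message] at hspec
  · rw [hi] at hspec
    obtain ⟨c, hc⟩ := Option.ne_none_iff_exists'.mp (hmin i (by omega))
    rw [accepts_iff_of_message ((hcross i).trans hc) ((hcross _).trans hspec)]
    by_cases he : Even i
    · rw [accepts_iff_of_message hc hspec] at h₁
      simpa only [part, he, if_true] using h₁
    · rw [accepts_iff_of_message ((hmsg i).symm.trans hc) ((hmsg _).symm.trans hspec)] at h₂
      have hi0 : i ≠ 0 := by rintro rfl; simp at he
      simpa only [part, he, if_false, startPos, hi0] using h₂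

end Protocol

end OfflineTM

namespace OfflineTM

/-! ### Counting messages: time and space from a fooling set -/

section Counting

variable {α : Type*} (M : Machine α)

theorem run_succ (w : List α) (t : ℕ) : run M w (t + 1) = step M w (run M w t) := by
  rw [run, Function.iterate_succ_apply', ← run]

theorem natAbs_head_step_sub_le (w : List α) (c : Config M) (k : Fin M.tapes) :
    ((step M w c).head k - c.head k).natAbs ≤ 1 := by
  unfold step
  rcases action M w c with _ | ⟨q, d, f⟩
  · simp
  · rcases h : (f k).2 <;> simp [h, shift]

/-- A discrete intermediate value argument: a head moving in unit steps from `0` cannot skip a cell.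
Thus a bound on the number of visited cells confines the head to a window around `0`. -/
theorem mem_visited_of_mem_uIcc (w : List α) (t : ℕ) (k : Fin M.tapes) (z : ℤ)
    (hz : z ∈ Finset.uIcc 0 ((run M w t).head k)) :
    z ∈ (Finset.range (t + 1)).image fun s => (run M w s).head k := by
  induction t with
  | zero => simpa [run, init, eq_comm] using hz
  | succ t ih =>
    by_cases h : z = (run M w (t + 1)).head k
    · exact Finset.mem_image.2 ⟨t + 1, by simp, h.symm⟩
    · have h1 := natAbs_head_step_sub_le M w (run M w t) k
      rw [← run_succ] at h1
      have : z ∈ Finset.uIcc 0 ((run M w t).head k) := by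
        rw [Finset.mem_uIcc] at hz ⊢
        omega
      obtain ⟨s, hs, hs'⟩ := Finset.mem_image.1 (ih this)
      rw [Finset.mem_range] at hs
      exact Finset.mem_image.2 ⟨s, by rw [Finset.mem_range]; omega, hs'⟩

theorem natAbs_head_lt_cells (w : List α) (t : ℕ) (k : Fin M.tapes) :
    ((run M w t).head k).natAbs < cells M w t := by
  have h1 := Finset.card_le_card fun z hz => mem_visited_of_mem_uIcc M w t k z hz
  rw [Int.card_uIcc, sub_zero] at h1
  exact lt_of_lt_of_le (Nat.lt_of_succ_le h1)
    (Finset.single_le_sum (f := fun k => ((Finset.range (t + 1)).image fun s =>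
      (run M w s).head k).card) (fun _ _ => Nat.zero_le _) (Finset.mem_univ k))

theorem tape_eq_blank (w : List α) (t : ℕ) (k : Fin M.tapes) (z : ℤ)
    (hz : ∀ s < t, (run M w s).head k ≠ z) : (run M w t).tape k z = M.blank := by
  induction t with
  | zero => rfl
  | succ t ih =>
    have h1 := ih fun s hs => hz s (by omega)
    have h2 := hz t (by omega)
    rw [run_succ]
    unfold step
    rcases action M w (run M w t) with _ | ⟨q, d, f⟩
    · exact h1
    · simp only
      rw [Function.update_of_ne h2.symm, h1]

/-- The part of a configuration, apart from the position of the input head, that matters if the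
work heads have only visited the cells from `-S` to `S`. -/
def window (S : ℕ) (c : Config M) :
    M.State × (Fin M.tapes → Fin (2 * S + 1)) × (Fin M.tapes → Fin (2 * S + 1) → M.Sym) :=
  (c.state, fun k => Fin.ofNat (2 * S + 1) (c.head k + S).toNat, fun k i => c.tape k (i - S))

variable {M}

theorem inHead_message {X P Y : List α} {i : ℕ} {c : Config M}
    (h : message X P Y i = some c) : c.inHead = 0 := by
  classical
  rcases i with _ | i
  · simp only [message, Option.some.injEq] at h
    subst h; rfl
  · rw [message, Option.bind_eq_some_iff] at h
    obtain ⟨d, -, h⟩ := h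
    unfold exitConfig at h
    split_ifs at h
    rw [Option.some.injEq] at h
    subst h; rfl

/-- Under the space bound `window` loses nothing: the heads satisfy `|head| < S`, so the reduction
modulo `2 * S + 1` is harmless, the cells outside are still blank, and the input head of a message
is always `0`. -/
theorem message_eq_of_window_eq {X₁ X₂ P Y₁ Y₂ : List α} {i S : ℕ} {c₁ c₂ : Config M}
    (h₁ : message X₁ P Y₁ i = some c₁) (h₂ : message X₂ P Y₂ i = some c₂)
    (hS₁ : ∀ t, cells M (X₁ ++ (P ++ Y₁)) t ≤ S) (hS₂ : ∀ t, cells M (X₂ ++ (P ++ Y₂)) t ≤ S)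
    (h : window M S c₁ = window M S c₂) : c₁ = c₂ := by
  have key : ∀ (X Y : List α) (c : Config M), message X P Y i = some c →
      (∀ t, cells M (X ++ (P ++ Y)) t ≤ S) → c.inHead = 0 ∧
      (∀ k, (c.head k).natAbs < S) ∧ ∀ k z, S ≤ z.natAbs → c.tape k z = M.blank := by
    intro X Y c hc hS
    obtain ⟨t, -, ht, -⟩ := exists_run_of_message hc
    have hb : ∀ s k, ((run M (X ++ (P ++ Y)) s).head k).natAbs < S := fun s k =>
      (natAbs_head_lt_cells M _ s k).trans_le (hS s)
    refine ⟨inHead_message hc, fun k => ?_, fun k z hz => ?_⟩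
    · have := hb t k
      rwa [ht] at this
    · have := tape_eq_blank M (X ++ (P ++ Y)) t k z (fun s _ e => by
        have := hb s k
        rw [e] at this
        omega)
      rwa [ht] at this
  obtain ⟨p₁, b₁, t₁⟩ := key _ _ _ h₁ hS₁
  obtain ⟨p₂, b₂, t₂⟩ := key _ _ _ h₂ hS₂
  simp only [window, Prod.mk.injEq] at h
  obtain ⟨e1, e2, e3⟩ := h
  rcases c₁ with ⟨q₁, p₁', T₁, H₁⟩
  rcases c₂ with ⟨q₂, p₂', T₂, H₂⟩
  simp only at *
  congr 1
  · rw [p₁, p₂]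
  · funext k z
    by_cases hz : S ≤ z.natAbs
    · rw [t₁ k z hz, t₂ k z hz]
    · have := congrFun (congrFun e3 k) ⟨(z + S).toNat, by omega⟩
      simp only at this
      have hz' : (((z + S).toNat : ℕ) : ℤ) - S = z := by omega
      rwa [hz'] at this
  · funext k
    have := congrArg Fin.val (congrFun e2 k)
    have h1 := b₁ k
    have h2 := b₂ k
    simp only [Fin.ofNat] at this
    rw [Nat.mod_eq_of_lt (by omega), Nat.mod_eq_of_lt (by omega)] at this
    omega

/-- A machine that distinguishes the matching pairs of a fooling set of inputs, the two parts of
which are a distance of `P.length` apart, needs time or space. -/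
theorem card_le_of_fooling {ι : Type*} [Fintype ι] (X Y : ι → List α) (P : List α) (T S : ℕ)
    (hT : ∀ u, HaltsBy M (X u ++ (P ++ Y u)) T) (hS : ∀ u t, cells M (X u ++ (P ++ Y u)) t ≤ S)
    (hacc : ∀ u, Accepts M (X u ++ (P ++ Y u)))
    (hrej : ∀ u v, Accepts M (X u ++ (P ++ Y v)) → u = v) :
    Fintype.card ι ≤ (Nat.card M.State * (2 * S + 1) ^ M.tapes *
      (Nat.card M.Sym ^ (2 * S + 1)) ^ M.tapes + 1) ^ (T / (P.length + 1)) := by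
  classical
  have := M.finState
  have := M.finSym
  have := Fintype.ofFinite M.State
  have := Fintype.ofFinite M.Sym
  -- Message `0` is the initial configuration and need not be recorded. The value `none` stands for
  -- a round that does not take place; it accounts for the `+ 1` in the bound.
  let τ : ι → Fin (T / (P.length + 1)) → Option (M.State × (Fin M.tapes → Fin (2 * S + 1)) ×
      (Fin M.tapes → Fin (2 * S + 1) → M.Sym)) :=
    fun u i => (message (M := M) (X u) P (Y u) (i + 1)).map (window M S)
  have hτ : Function.Injective τ := by
    intro u v huv
    apply hrej
    refine accepts_of_message_eq (fun i => ?_) ⟨T, hT u⟩ (hacc u) (hacc v)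
    have hbig : ∀ w, T / (P.length + 1) < i → message (M := M) (X w) P (Y w) i = none := by
      intro w hi
      by_contra hsome
      obtain ⟨c, hc⟩ := Option.ne_none_iff_exists'.mp hsome
      obtain ⟨t, ht, -, ht'⟩ := exists_run_of_message hc
      have h1 := ht' T (hT w)
      rw [Nat.div_lt_iff_lt_mul (by omega)] at hi
      omega
    rcases i with _ | i
    · rfl
    by_cases hi : T / (P.length + 1) < i + 1
    · rw [hbig u hi, hbig v hi]
    · have := congrFun huv ⟨i, by omega⟩
      simp only [τ] at this
      rcases hu : message (M := M) (X u) P (Y u) (i + 1) with _ | c <;>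
        rcases hv : message (M := M) (X v) P (Y v) (i + 1) with _ | d
      · rfl
      · simp [hu, hv] at this
      · simp [hu, hv] at this
      · simp only [hu, hv, Option.map_some, Option.some.injEq] at this
        rw [message_eq_of_window_eq hu hv (hS u) (hS v) this]
  have := Fintype.card_le_of_injective τ hτ
  simpa [Nat.card_eq_fintype_card, mul_assoc] using this

/-- The number of steps of a machine that distinguishes the matching pairs of a fooling set of
size `2 ^ m`, multiplied by its space, is at least a constant times `m * P.length`. -/
theorem exists_mul_le_of_fooling (M : Machine α) : ∃ C : ℕ, ∀ (m : ℕ)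
    (X Y : (Fin m → Bool) → List α) (P : List α) (T S : ℕ),
    (∀ u, HaltsBy M (X u ++ (P ++ Y u)) T) → (∀ u t, cells M (X u ++ (P ++ Y u)) t ≤ S) →
    (∀ u, Accepts M (X u ++ (P ++ Y u))) → (∀ u v, Accepts M (X u ++ (P ++ Y v)) → u = v) →
    m * P.length ≤ C * (T * S) := by
  have := M.finState
  have := M.finSym
  set q := Nat.card M.State with hq
  set g := Nat.card M.Sym with hg
  set k := M.tapes with hk
  refine ⟨q + 3 * k + 3 * g * k + 1, fun m X Y P T S hT hS hacc hrej => ?_⟩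
  have hcard := card_le_of_fooling X Y P T S hT hS hacc hrej
  -- The initially scanned cell counts as visited. With `S ≥ 1` the additive constants in the
  -- exponent are absorbed into a multiple of `S`.
  have hS1 : 1 ≤ S := by
    have := natAbs_head_lt_cells M (X default ++ (P ++ Y default)) 0 ⟨0, M.tapes_pos⟩
    have := hS default 0
    omega
  have hle : q * (2 * S + 1) ^ k * (g ^ (2 * S + 1)) ^ k + 1 ≤
      2 ^ ((q + 3 * k + 3 * g * k + 1) * S) := by
    have h1 : q ≤ 2 ^ q := Nat.lt_two_pow_self.le
    have h2 : (2 * S + 1) ^ k ≤ 2 ^ ((2 * S + 1) * k) := by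
      rw [pow_mul]; exact Nat.pow_le_pow_left Nat.lt_two_pow_self.le _
    have h3 : (g ^ (2 * S + 1)) ^ k ≤ 2 ^ (g * (2 * S + 1) * k) := by
      rw [pow_mul, pow_mul]
      exact Nat.pow_le_pow_left (Nat.pow_le_pow_left Nat.lt_two_pow_self.le _) _
    have h4 : q * (2 * S + 1) ^ k * (g ^ (2 * S + 1)) ^ k ≤
        2 ^ (q + (2 * S + 1) * k + g * (2 * S + 1) * k) :=
      (Nat.mul_le_mul (Nat.mul_le_mul h1 h2) h3).trans_eq (by rw [← pow_add, ← pow_add])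
    have h5 : 1 ≤ 2 ^ (q + (2 * S + 1) * k + g * (2 * S + 1) * k) := Nat.one_le_two_pow
    calc _ ≤ 2 ^ (q + (2 * S + 1) * k + g * (2 * S + 1) * k) * 2 := by omega
      _ = 2 ^ (q + (2 * S + 1) * k + g * (2 * S + 1) * k + 1) := (pow_succ _ _).symm
      _ ≤ _ := by
        apply Nat.pow_le_pow_right (by norm_num)
        have h6 : 2 * S + 1 ≤ 3 * S := by omega
        have h7 : q ≤ q * S := Nat.le_mul_of_pos_right _ hS1
        have h8 : (2 * S + 1) * k ≤ 3 * S * k := Nat.mul_le_mul_right _ h6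
        have h9 : g * (2 * S + 1) * k ≤ g * (3 * S) * k :=
          Nat.mul_le_mul_right _ (Nat.mul_le_mul_left _ h6)
        calc _ ≤ q * S + 3 * S * k + g * (3 * S) * k + S := by omega
          _ = _ := by ring
  have hm : 2 ^ m ≤ 2 ^ ((q + 3 * k + 3 * g * k + 1) * S * (T / (P.length + 1))) := by
    rw [pow_mul]
    simpa using hcard.trans (Nat.pow_le_pow_left hle _)
  have hm' := (Nat.pow_le_pow_iff_right (by norm_num)).1 hm
  calc m * P.length ≤ (q + 3 * k + 3 * g * k + 1) * S * (T / (P.length + 1)) * (P.length + 1) :=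
        Nat.mul_le_mul hm' (by omega)
    _ = (q + 3 * k + 3 * g * k + 1) * S * (T / (P.length + 1) * (P.length + 1)) := by ring
    _ ≤ (q + 3 * k + 3 * g * k + 1) * S * T := Nat.mul_le_mul_left _ (Nat.div_mul_le_self _ _)
    _ = _ := by ring

end Counting

end OfflineTM

namespace Trace

/-! ### Traces given by functions of the position, and tools for bounding and deriving WCP -/

section Sequences

variable {Thr Lck Var : Type*} (N : ℕ) (ev : ℕ → Event Thr Lck Var)

/-- The sequence of the first `N` values of `ev`. -/
def ofSeq : List (Event Thr Lck Var) := (List.range N).map ev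

theorem length_ofSeq : (ofSeq N ev).length = N := by simp [ofSeq]

variable {N ev}

theorem val_lt (i : Fin (ofSeq N ev).length) : i.val < N := by
  have := i.isLt
  simpa only [length_ofSeq] using this

theorem get_ofSeq (i : Fin (ofSeq N ev).length) : (ofSeq N ev).get i = ev i := by
  rw [List.get_eq_getElem]
  simp only [ofSeq, List.getElem_map, List.getElem_range]

theorem op_ofSeq (i : Fin (ofSeq N ev).length) : op (ofSeq N ev) i = (ev i).op := by
  rw [op, get_ofSeq]

theorem thr_ofSeq (i : Fin (ofSeq N ev).length) : thr (ofSeq N ev) i = (ev i).thread := by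
  rw [thr, get_ofSeq]

/-- The position `k` of the sequence. -/
def pos (k : ℕ) (h : k < N) : Fin (ofSeq N ev).length := ⟨k, by rwa [length_ofSeq]⟩

theorem HB.le {σ : List (Event Thr Lck Var)} {i j : Fin σ.length} (h : HB σ i j) : i ≤ j := by
  induction h with
  | thread h => exact h.elim (fun h => h.1.le) fun h => h.le
  | lock l _ _ h => exact h.le
  | trans _ _ h₁ h₂ => exact h₁.trans h₂

/-- `mt` maps acquires to their releases. -/
structure IsMatching (N : ℕ) (ev : ℕ → Event Thr Lck Var) (mt : ℕ → ℕ) : Prop where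
  lt : ∀ a l, a < N → (ev a).op = .acq l → a < mt a ∧ mt a < N
  eq : ∀ a l, a < N → (ev a).op = .acq l → ev (mt a) = ⟨(ev a).thread, .rel l⟩
  free : ∀ a l k, a < N → (ev a).op = .acq l → a < k → k < mt a →
    (ev k).op ≠ .acq l ∧ (ev k).op ≠ .rel l
  surj : ∀ r l, r < N → (ev r).op = .rel l → ∃ a < N, (ev a).op = .acq l ∧ mt a = r
  nested : ∀ c a l l', c < a → a < mt c → (ev c).op = .acq l → (ev a).op = .acq l' → c < N →
    a < N → (ev a).thread = (ev c).thread → mt a < mt c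

variable {mt : ℕ → ℕ}

/-- By `free`, no release of the lock by any thread comes between `a` and `mt a`, so `mt a` is the
earliest one in the thread of `a`. -/
theorem IsMatching.match_iff (h : IsMatching N ev mt) {a r : Fin (ofSeq N ev).length} {l : Lck}
    (ha : op _ a = .acq l) : Match _ a r ↔ r.val = mt a := by
  have ha' := ha
  rw [op_ofSeq] at ha'
  have h1 := h.lt a l (val_lt a) ha'
  have h2 := h.eq a l (val_lt a) ha'
  have key : ∀ r', op (ofSeq N ev) r' = .rel l → ThreadLT _ a r' → mt a ≤ r'.val := by
    intro r' hr' hlt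
    by_contra hcon
    refine (h.free a l r' (val_lt a) ha' hlt.1 (by omega)).2 ?_
    rwa [← op_ofSeq]
  have hr0 : op (ofSeq N ev) (pos (mt a) h1.2) = .rel l := by
    rw [op_ofSeq]; simp only [pos]; rw [h2]
  have ht0 : ThreadLT (ofSeq N ev) a (pos (mt a) h1.2) := by
    refine ⟨h1.1, ?_⟩
    rw [thr_ofSeq, thr_ofSeq]; simp only [pos]; rw [h2]
  constructor
  · rintro ⟨l', e1, e2, e3, e4⟩
    rw [ha, Op.acq.injEq] at e1
    subst e1
    exact le_antisymm (e4 _ hr0 ht0) (key _ e2 e3)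
  · intro e
    have : r = pos (mt a) h1.2 := Fin.ext e
    subst this
    exact ⟨l, ha, hr0, ht0, key⟩

theorem IsMatching.inCS (h : IsMatching N ev mt) {a e : Fin (ofSeq N ev).length} {l : Lck}
    (ha : op _ a = .acq l) (hle : a ≤ e) (hmt : e.val ≤ mt a)
    (hthr : (ev a).thread = (ev e).thread) : InCS _ a e := by
  refine ⟨⟨l, ha⟩, ?_, fun r hr => ?_⟩
  · rcases hle.eq_or_lt with rfl | hlt
    · exact Or.inr rfl
    · exact Or.inl ⟨hlt, by rwa [thr_ofSeq, thr_ofSeq]⟩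
  · rw [h.match_iff ha] at hr
    show e.val ≤ r.val
    omega

theorem IsMatching.isTrace (h : IsMatching N ev mt) : IsTrace (ofSeq N ev) := by
  have hm : ∀ (a : Fin (ofSeq N ev).length) l, op _ a = .acq l → ∃ r, Match (ofSeq N ev) a r := by
    intro a l ha
    have ha' := ha
    rw [op_ofSeq] at ha'
    exact ⟨pos (mt a) (h.lt a l (val_lt a) ha').2, (h.match_iff ha).2 rfl⟩
  refine ⟨fun a₁ a₂ l h₁ h₂ hlt => ?_, fun c a l ha hca => ?_, fun r l hr => ?_⟩
  · obtain ⟨r, hr⟩ := hm a₁ l h₁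
    refine ⟨r, hr, ?_⟩
    have hr' := (h.match_iff h₁).1 hr
    rw [op_ofSeq] at h₁ h₂
    by_contra hcon
    have hcon' : a₂.val ≤ r.val := by
      have : a₂ ≤ r := not_lt.1 hcon
      exact this
    rcases hcon'.eq_or_lt with e | e
    · have := h.eq a₁ l (val_lt _) h₁
      rw [← hr', ← e] at this
      rw [this] at h₂
      simp at h₂
    · exact (h.free a₁ l a₂ (val_lt _) h₁ hlt (by omega)).1 h₂
  · obtain ⟨r, hr⟩ := hm a l ha
    refine ⟨r, hr, ?_⟩
    have hr' := (h.match_iff ha).1 hr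
    obtain ⟨⟨l', hc⟩, hle, hmt⟩ := hca
    obtain ⟨s, hs⟩ := hm c l' hc
    have hs' := (h.match_iff hc).1 hs
    have has : a.val ≤ s.val := hmt s hs
    have ha' := ha
    have hc' := hc
    rw [op_ofSeq] at ha' hc'
    have e1 := h.eq a l (val_lt _) ha'
    have e2 := h.eq c l' (val_lt _) hc'
    have l1 := (h.lt a l (val_lt _) ha').1
    rcases hle with hlt | rfl
    · have ht : (ev a).thread = (ev c).thread := by
        rw [← thr_ofSeq, ← thr_ofSeq]; exact hlt.2.symm
      have hlt1 : c.val < a.val := hlt.1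
      have hne : a.val ≠ mt c := by
        intro e; rw [← e] at e2; rw [e2] at ha'; simp at ha'
      have := h.nested c a l' l hlt1 (by omega) hc' ha' (val_lt _) (val_lt _) ht
      exact h.inCS hc (show c.val ≤ r.val by omega) (by omega) (by rw [hr', e1, ht])
    · exact h.inCS hc (show c.val ≤ r.val by omega) (by omega) (by rw [hr', e2])
  · have hr' := hr
    rw [op_ofSeq] at hr'
    obtain ⟨a, haN, ha, e⟩ := h.surj r l (val_lt _) hr'
    exact ⟨pos a haN, (h.match_iff (l := l) (by rw [op_ofSeq]; exact ha)).2 e.symm⟩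

/-- Bounds on the events that weakly causally precede a given event. -/
theorem IsMatching.lt_of_prec (h : IsMatching N ev mt) (B : ℕ → ℕ)
    (hmono : ∀ i j, i ≤ j → j < N → B i ≤ B j)
    (hconf : ∀ a l x e e', a < N → (ev a).op = .acq l → e < N → mt a < e → a ≤ e' → e' ≤ mt a →
      ((ev e).op = .read x ∨ (ev e).op = .write x) →
      ((ev e').op = .read x ∨ (ev e').op = .write x) →
      ((ev e).op = .write x ∨ (ev e').op = .write x) → (ev e).thread ≠ (ev e').thread → mt a < B e)
    (hrel : ∀ a r l, a < N → r < N → (ev a).op = .acq l → (ev r).op = .rel l → a < B r →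
      mt a < B r)
    {i j : Fin (ofSeq N ev).length} (hij : Prec _ i j) : i.val < B j := by
  induction hij with
  | @conflict r e e' l hr he hlt hcs hc =>
    obtain ⟨a, hm, hin⟩ := hcs
    obtain ⟨l', ha, -⟩ := id hm
    rw [h.match_iff ha] at hm
    obtain ⟨x, h1, h2, h3, h4⟩ := hc
    simp only [Accesses, Writes, op_ofSeq, thr_ofSeq] at h1 h2 h3 h4 ha
    have hae : a ≤ e' := hin.2.1.elim (fun h => h.1.le) fun h => h.le
    have hem : e' ≤ r := hin.2.2 r ((h.match_iff (by rwa [op_ofSeq])).2 hm)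
    rw [hm]
    exact hconf a l' x e e' (val_lt _) ha (val_lt _) (by rw [← hm]; exact hlt) hae
      (by rw [← hm]; exact hem) h1 h2 h3 h4
  | @release r₁ r₂ e₁ e₂ l hr₁ hr₂ hlt h₁ h₂ _ ih =>
    obtain ⟨a, hm, hin⟩ := h₁
    obtain ⟨l', ha, hr₁', -⟩ := id hm
    rw [h.match_iff ha] at hm
    have hl : l = l' := by rw [hr₁] at hr₁'; simpa using hr₁'
    subst hl
    have hae : a ≤ e₁ := hin.2.1.elim (fun h => h.1.le) fun h => h.le
    obtain ⟨a₂, hm₂, hin₂⟩ := h₂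
    have hem : e₂ ≤ r₂ := hin₂.2.2 r₂ hm₂
    -- Now `a ≤ e₁ < B e₂ ≤ B r₂`, so the closure condition `hrel` applies to the section of `a`.
    have := hmono e₂ r₂ hem (val_lt _)
    have hae' : a.val ≤ e₁.val := hae
    rw [hm]
    rw [op_ofSeq] at ha hr₂
    exact hrel a r₂ l (val_lt _) (val_lt _) ha hr₂ (by omega)
  -- Of happens-before, only its compatibility with the order of positions is needed.
  | comp_hb _ hjk ih => exact ih.trans_le (hmono _ _ hjk.le (val_lt _))
  | hb_comp hij _ ih => exact lt_of_le_of_lt (show _ ≤ _ from hij.le) ih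

/-- Happens-before in terms of positions. -/
def HBPos (N : ℕ) (ev : ℕ → Event Thr Lck Var) (i j : ℕ) : Prop :=
  ∃ (hi : i < N) (hj : j < N), HB (ofSeq N ev) (pos i hi) (pos j hj)

/-- Weak-causally-precedes in terms of positions. -/
def PrecPos (N : ℕ) (ev : ℕ → Event Thr Lck Var) (i j : ℕ) : Prop :=
  ∃ (hi : i < N) (hj : j < N), Prec (ofSeq N ev) (pos i hi) (pos j hj)

theorem HBPos.thread {i j : ℕ} (hj : j < N) (hij : i ≤ j)
    (ht : (ev i).thread = (ev j).thread) : HBPos N ev i j := by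
  refine ⟨by omega, hj, HB.thread ?_⟩
  rcases hij.eq_or_lt with rfl | hlt
  · exact Or.inr rfl
  · exact Or.inl ⟨hlt, by rw [thr_ofSeq, thr_ofSeq]; exact ht⟩

theorem HBPos.lock {i j : ℕ} {l : Lck} (hj : j < N) (hij : i < j) (hi : (ev i).op = .rel l)
    (ha : (ev j).op = .acq l) : HBPos N ev i j :=
  ⟨by omega, hj, HB.lock l (by rw [op_ofSeq]; exact hi) (by rw [op_ofSeq]; exact ha) hij⟩

theorem HBPos.trans {i j k : ℕ} (h₁ : HBPos N ev i j) (h₂ : HBPos N ev j k) : HBPos N ev i k := by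
  obtain ⟨hi, hj, h₁⟩ := h₁
  obtain ⟨_, hk, h₂⟩ := h₂
  exact ⟨hi, hk, h₁.trans h₂⟩

theorem HBPos.prec {i j k : ℕ} (h₁ : HBPos N ev i j) (h₂ : PrecPos N ev j k) :
    PrecPos N ev i k := by
  obtain ⟨hi, hj, h₁⟩ := h₁
  obtain ⟨_, hk, h₂⟩ := h₂
  exact ⟨hi, hk, .hb_comp h₁ h₂⟩

theorem PrecPos.hb {i j k : ℕ} (h₁ : PrecPos N ev i j) (h₂ : HBPos N ev j k) :
    PrecPos N ev i k := by
  obtain ⟨hi, hj, h₁⟩ := h₁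
  obtain ⟨_, hk, h₂⟩ := h₂
  exact ⟨hi, hk, .comp_hb h₁ h₂⟩

theorem IsMatching.inCSRel (h : IsMatching N ev mt) {a r : ℕ} {l : Lck} (ha : (ev a).op = .acq l)
    (hr : mt a = r) (hrN : r < N) {e : ℕ} (hae : a ≤ e) (her : e ≤ r)
    (ht : (ev a).thread = (ev e).thread) :
    InCSRel (ofSeq N ev) (pos r hrN) (pos e (by omega)) := by
  have ha' : op (ofSeq N ev) (pos a (by omega)) = .acq l := by rw [op_ofSeq]; exact ha
  rw [← hr] at her
  exact ⟨pos a (by omega), (h.match_iff ha').2 hr.symm, h.inCS ha' hae her ht⟩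

/-- Rule (b) in its most useful instance: the acquire of the first section and the release of the
second serve as the ordered events inside them. -/
theorem IsMatching.release (h : IsMatching N ev mt) {a₁ a₂ : ℕ} {l : Lck}
    (h₁ : (ev a₁).op = .acq l) (h₂ : (ev a₂).op = .acq l) (hlt : mt a₁ < a₂)
    (h₂N : a₂ < N) (hp : PrecPos N ev a₁ (mt a₂)) : PrecPos N ev (mt a₁) (mt a₂) := by
  obtain ⟨ha, hr, hp⟩ := hp
  have hlt₂ := h.lt a₂ l h₂N h₂
  have e₁ := h.eq a₁ l ha h₁
  have e₂ := h.eq a₂ l h₂N h₂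
  have hlt₁ := h.lt a₁ l ha h₁
  refine ⟨hlt₁.2, hr, Prec.release l ?_ ?_ ?_ (h.inCSRel h₁ rfl hlt₁.2 le_rfl hlt₁.1.le rfl)
    (h.inCSRel h₂ rfl hr hlt₂.1.le le_rfl (by rw [e₂])) hp⟩
  · rw [op_ofSeq]; simp only [pos]; rw [e₁]
  · rw [op_ofSeq]; simp only [pos]; rw [e₂]
  · exact hlt.trans hlt₂.1

theorem IsMatching.conflict (h : IsMatching N ev mt) {a₁ a₂ e₁ e₂ : ℕ} {l : Lck} {x : Var}
    (h₁ : (ev a₁).op = .acq l) (h₂ : (ev a₂).op = .acq l) (hlt : mt a₁ < a₂)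
    (ha₁ : a₁ ≤ e₁) (hm₁ : e₁ ≤ mt a₁) (ht₁ : (ev a₁).thread = (ev e₁).thread)
    (ha₂ : a₂ ≤ e₂) (hm₂ : e₂ ≤ mt a₂) (ht₂ : (ev a₂).thread = (ev e₂).thread) (he₂ : e₂ < N)
    (hw₁ : (ev e₁).op = .write x) (hw₂ : (ev e₂).op = .write x)
    (ht : (ev e₂).thread ≠ (ev e₁).thread) : PrecPos N ev (mt a₁) e₂ := by
  have ha : a₁ < N := by omega
  have e := h.eq a₁ l ha h₁
  refine ⟨by omega, he₂, Prec.conflict l ?_ ?_ ?_ (h.inCSRel h₁ rfl (by omega) ha₁ hm₁ ht₁)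
    ⟨x, ?_, ?_, ?_, ?_⟩⟩
  · rw [op_ofSeq]; simp only [pos]; rw [e]
  · have : op (ofSeq N ev) (pos a₂ (by omega)) = .acq l := by rw [op_ofSeq]; exact h₂
    exact ⟨_, this, h.inCS this ha₂ hm₂ ht₂⟩
  · exact hlt.trans_le ha₂
  · exact Or.inr (by rw [op_ofSeq]; exact hw₂)
  · exact Or.inr (by rw [op_ofSeq]; exact hw₁)
  · exact Or.inl (by rw [Writes, op_ofSeq]; exact hw₂)
  · rw [thr_ofSeq, thr_ofSeq]; exact ht

end Sequences

end Trace

namespace Trace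

/-- Three threads, four locks and two variables. -/
structure Palette (Thr Lck Var : Type*) where
  (t₀ t₁ t₂ : Thr)
  (p y : Lck)
  c : Bool → Lck
  (x z : Var)
  t₀₁ : t₀ ≠ t₁
  t₀₂ : t₀ ≠ t₂
  t₁₂ : t₁ ≠ t₂
  py : p ≠ y
  pc : ∀ b, p ≠ c b
  yc : ∀ b, y ≠ c b
  c_inj : Function.Injective c
  xz : x ≠ z

/-! ### The traces encoding two bit strings -/

namespace Palette

variable {Thr Lck Var : Type*} (A : Palette Thr Lck Var)

/-- The part of the left half of the trace that encodes a bit `b`. The critical sections over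
`p` and `c b` are chained by the critical sections over `y`. -/
def leftBlock (b : Bool) : ℕ → Event Thr Lck Var
  | 0 => ⟨A.t₁, .acq (A.c b)⟩
  | 1 => ⟨A.t₁, .acq A.y⟩
  | 2 => ⟨A.t₁, .rel A.y⟩
  | 3 => ⟨A.t₀, .acq A.y⟩
  | 4 => ⟨A.t₀, .rel A.y⟩
  | 5 => ⟨A.t₀, .rel A.p⟩
  | 6 => ⟨A.t₀, .acq A.p⟩
  | 7 => ⟨A.t₀, .acq A.y⟩
  | 8 => ⟨A.t₀, .rel A.y⟩
  | 9 => ⟨A.t₁, .acq A.y⟩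
  | 10 => ⟨A.t₁, .rel A.y⟩
  | _ => ⟨A.t₁, .rel (A.c b)⟩

/-- The part of the right half of the trace that encodes a bit `b`. -/
def rightBlock (b : Bool) : ℕ → Event Thr Lck Var
  | 0 => ⟨A.t₂, .acq A.p⟩
  | 1 => ⟨A.t₂, .write A.x⟩
  | 2 => ⟨A.t₂, .rel A.p⟩
  | 3 => ⟨A.t₂, .acq (A.c b)⟩
  | _ => ⟨A.t₂, .rel (A.c b)⟩

/-- The left half of the trace, encoding the bits `u 0, …, u (m - 1)`. -/
def left (m : ℕ) (u : ℕ → Bool) (k : ℕ) : Event Thr Lck Var :=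
  if k = 0 then ⟨A.t₀, .acq A.p⟩
  else if k = 1 then ⟨A.t₀, .write A.x⟩
  else if k = 12 * m + 2 then ⟨A.t₀, .rel A.p⟩
  else A.leftBlock (u ((k - 2) / 12)) ((k - 2) % 12)

/-- The right half of the trace, encoding the bits `v 0, v 1, …`. -/
def right (v : ℕ → Bool) (k : ℕ) : Event Thr Lck Var := A.rightBlock (v (k / 5)) (k % 5)

/-- The two halves of the trace, separated by `d` irrelevant events. -/
def ev (m d : ℕ) (u v : ℕ → Bool) (k : ℕ) : Event Thr Lck Var :=
  if k < 12 * m + 3 then A.left m u k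
  else if k < 12 * m + 3 + d then ⟨A.t₂, .read A.z⟩
  else A.right v (k - (12 * m + 3 + d))

/-- The release matching the acquire at a given position. -/
def mt (m d k : ℕ) : ℕ :=
  if k = 0 then 7
  else if k < 12 * m + 3 then
    if (k - 2) % 12 = 0 then k + 11
    else if (k - 2) % 12 = 6 then min (k + 11) (12 * m + 2)
    else k + 1
  else if (k - (12 * m + 3 + d)) % 5 = 0 then k + 2
  else k + 1

/-- The number of bits of `u` that are found, in this order, among the first `j` bits of `v`. -/
def greedy (u v : ℕ → Bool) : ℕ → ℕ
  | 0 => 0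
  | j + 1 => if u (greedy u v j) = v j then greedy u v j + 1 else greedy u v j

theorem greedy_le (u v : ℕ → Bool) (j : ℕ) : greedy u v j ≤ j := by
  induction j with
  | zero => rfl
  | succ j ih => rw [greedy]; split_ifs <;> omega

/-- The count grows by at most one per bit of `v`, so it equals `j` only if no bit was wasted. -/
theorem eq_of_greedy_eq {u v : ℕ → Bool} {j : ℕ} (h : greedy u v j = j) : ∀ i < j, u i = v i := by
  induction j with
  | zero => simp
  | succ j ih =>
    have h1 := greedy_le u v j
    rw [greedy] at h
    split_ifs at h with h2
    · have h3 : greedy u v j = j := by omega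
      intro i hi
      rcases Nat.lt_succ_iff_lt_or_eq.1 hi with hi | rfl
      · exact ih h3 i hi
      · rwa [h3] at h2
    · omega

/-- Only events at positions smaller than this weakly causally precede the event at
position `k`. -/
def bound (m d : ℕ) (u v : ℕ → Bool) (k : ℕ) : ℕ :=
  if k < 12 * m + 3 + d then 0
  else
    let r := k - (12 * m + 3 + d)
    if r % 5 = 4 ∧ u (greedy u v (r / 5)) = v (r / 5) then 12 * greedy u v (r / 5) + 14
    else 12 * greedy u v (r / 5) + 8

variable (m d : ℕ) (u v : ℕ → Bool)

theorem ev_zero : A.ev m d u v 0 = ⟨A.t₀, .acq A.p⟩ := by simp [ev, left]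

theorem ev_one : A.ev m d u v 1 = ⟨A.t₀, .write A.x⟩ := by
  have : 1 < 12 * m + 3 := by omega
  simp [ev, left, this]

theorem ev_last : A.ev m d u v (12 * m + 2) = ⟨A.t₀, .rel A.p⟩ := by simp [ev, left]

variable {m d u v}

theorem ev_left {i o : ℕ} (hi : i < m) (ho : o < 12) :
    A.ev m d u v (2 + 12 * i + o) = A.leftBlock (u i) o := by
  have h1 : 2 + 12 * i + o < 12 * m + 3 := by omega
  have h2 : 2 + 12 * i + o ≠ 0 := by omega
  have h3 : 2 + 12 * i + o ≠ 1 := by omega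
  have h4 : 2 + 12 * i + o ≠ 12 * m + 2 := by omega
  have h5 : (2 + 12 * i + o - 2) / 12 = i := by omega
  have h6 : (2 + 12 * i + o - 2) % 12 = o := by omega
  rw [ev, if_pos h1, left, if_neg h2, if_neg h3, if_neg h4, h5, h6]

theorem ev_pad {k : ℕ} (h₁ : 12 * m + 3 ≤ k) (h₂ : k < 12 * m + 3 + d) :
    A.ev m d u v k = ⟨A.t₂, .read A.z⟩ := by
  rw [ev, if_neg (by omega), if_pos h₂]

theorem ev_right {j o : ℕ} (ho : o < 5) :
    A.ev m d u v (12 * m + 3 + d + 5 * j + o) = A.rightBlock (v j) o := by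
  have h1 : (12 * m + 3 + d + 5 * j + o - (12 * m + 3 + d)) / 5 = j := by omega
  have h2 : (12 * m + 3 + d + 5 * j + o - (12 * m + 3 + d)) % 5 = o := by omega
  rw [ev, if_neg (by omega), if_neg (by omega), right, h1, h2]

theorem position_cases {k : ℕ} (hk : k < 12 * m + 3 + d + 5 * m) :
    k = 0 ∨ k = 1 ∨ (∃ i o, i < m ∧ o < 12 ∧ k = 2 + 12 * i + o) ∨ k = 12 * m + 2 ∨
      (12 * m + 3 ≤ k ∧ k < 12 * m + 3 + d) ∨
      ∃ j o, j < m ∧ o < 5 ∧ k = 12 * m + 3 + d + 5 * j + o := by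
  by_cases h0 : k = 0
  · exact Or.inl h0
  by_cases h1 : k = 1
  · exact Or.inr (Or.inl h1)
  by_cases h2 : k < 12 * m + 2
  · exact Or.inr (Or.inr (Or.inl ⟨(k - 2) / 12, (k - 2) % 12, by omega, by omega, by omega⟩))
  by_cases h3 : k = 12 * m + 2
  · exact Or.inr (Or.inr (Or.inr (Or.inl h3)))
  by_cases h4 : k < 12 * m + 3 + d
  · exact Or.inr (Or.inr (Or.inr (Or.inr (Or.inl ⟨by omega, h4⟩))))
  · exact Or.inr (Or.inr (Or.inr (Or.inr (Or.inr ⟨(k - (12 * m + 3 + d)) / 5,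
      (k - (12 * m + 3 + d)) % 5, by omega, by omega, by omega⟩))))

/-- The acquires of the trace. -/
theorem acq_cases {k : ℕ} {l : Lck} (hk : k < 12 * m + 3 + d + 5 * m)
    (h : (A.ev m d u v k).op = .acq l) :
    (k = 0 ∧ l = A.p) ∨
    (∃ i < m, k = 2 + 12 * i ∧ l = A.c (u i)) ∨
    (∃ i < m, k = 2 + 12 * i + 6 ∧ l = A.p) ∨
    (∃ i < m, (k = 2 + 12 * i + 1 ∨ k = 2 + 12 * i + 3 ∨ k = 2 + 12 * i + 7 ∨
      k = 2 + 12 * i + 9) ∧ l = A.y) ∨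
    (∃ j < m, k = 12 * m + 3 + d + 5 * j ∧ l = A.p) ∨
    (∃ j < m, k = 12 * m + 3 + d + 5 * j + 3 ∧ l = A.c (v j)) := by
  rcases position_cases hk with rfl | rfl | ⟨i, o, hi, ho, rfl⟩ | rfl | hk | ⟨j, o, hj, ho, rfl⟩
  · rw [ev_zero] at h; simp at h; simp [h]
  · rw [ev_one] at h; simp at h
  · rw [ev_left A hi ho] at h
    interval_cases o <;> simp [leftBlock] at h <;> subst h
    · exact Or.inr (Or.inl ⟨i, hi, by simp⟩)
    · exact Or.inr (Or.inr (Or.inr (Or.inl ⟨i, hi, by simp⟩)))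
    · exact Or.inr (Or.inr (Or.inr (Or.inl ⟨i, hi, by simp⟩)))
    · exact Or.inr (Or.inr (Or.inl ⟨i, hi, by simp⟩))
    · exact Or.inr (Or.inr (Or.inr (Or.inl ⟨i, hi, by simp⟩)))
    · exact Or.inr (Or.inr (Or.inr (Or.inl ⟨i, hi, by simp⟩)))
  · rw [ev_last] at h; simp at h
  · rw [ev_pad A hk.1 hk.2] at h; simp at h
  · rw [ev_right A ho] at h
    interval_cases o <;> simp [rightBlock] at h <;> subst h
    · exact Or.inr (Or.inr (Or.inr (Or.inr (Or.inl ⟨j, hj, by simp⟩))))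
    · exact Or.inr (Or.inr (Or.inr (Or.inr (Or.inr ⟨j, hj, by simp⟩))))

/-- The releases of the trace. -/
theorem rel_cases {k : ℕ} {l : Lck} (hk : k < 12 * m + 3 + d + 5 * m)
    (h : (A.ev m d u v k).op = .rel l) :
    (k = 12 * m + 2 ∧ l = A.p) ∨
    (∃ i < m, k = 2 + 12 * i + 11 ∧ l = A.c (u i)) ∨
    (∃ i < m, k = 2 + 12 * i + 5 ∧ l = A.p) ∨
    (∃ i < m, (k = 2 + 12 * i + 2 ∨ k = 2 + 12 * i + 4 ∨ k = 2 + 12 * i + 8 ∨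
      k = 2 + 12 * i + 10) ∧ l = A.y) ∨
    (∃ j < m, k = 12 * m + 3 + d + 5 * j + 2 ∧ l = A.p) ∨
    (∃ j < m, k = 12 * m + 3 + d + 5 * j + 4 ∧ l = A.c (v j)) := by
  rcases position_cases hk with rfl | rfl | ⟨i, o, hi, ho, rfl⟩ | rfl | hk | ⟨j, o, hj, ho, rfl⟩
  · rw [ev_zero] at h; simp at h
  · rw [ev_one] at h; simp at h
  · rw [ev_left A hi ho] at h
    interval_cases o <;> simp [leftBlock] at h <;> subst h
    · exact Or.inr (Or.inr (Or.inr (Or.inl ⟨i, hi, by simp⟩)))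
    · exact Or.inr (Or.inr (Or.inr (Or.inl ⟨i, hi, by simp⟩)))
    · exact Or.inr (Or.inr (Or.inl ⟨i, hi, by simp⟩))
    · exact Or.inr (Or.inr (Or.inr (Or.inl ⟨i, hi, by simp⟩)))
    · exact Or.inr (Or.inr (Or.inr (Or.inl ⟨i, hi, by simp⟩)))
    · exact Or.inr (Or.inl ⟨i, hi, by simp⟩)
  · rw [ev_last] at h; simp at h; exact Or.inl ⟨rfl, h.symm⟩
  · rw [ev_pad A hk.1 hk.2] at h; simp at h
  · rw [ev_right A ho] at h
    interval_cases o <;> simp [rightBlock] at h <;> subst h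
    · exact Or.inr (Or.inr (Or.inr (Or.inr (Or.inl ⟨j, hj, by simp⟩))))
    · exact Or.inr (Or.inr (Or.inr (Or.inr (Or.inr ⟨j, hj, by simp⟩))))

theorem mt_c {i : ℕ} (hi : i < m) : mt m d (2 + 12 * i) = 2 + 12 * i + 11 := by
  unfold mt; split_ifs <;> omega

theorem mt_p {i : ℕ} (hi : i < m) :
    mt m d (2 + 12 * i + 6) = if i + 1 = m then 12 * m + 2 else 2 + 12 * (i + 1) + 5 := by
  unfold mt; split_ifs <;> first | omega | contradiction

theorem mt_y {i o : ℕ} (hi : i < m) (ho : o = 1 ∨ o = 3 ∨ o = 7 ∨ o = 9) :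
    mt m d (2 + 12 * i + o) = 2 + 12 * i + o + 1 := by
  unfold mt; split_ifs <;> omega

theorem mt_right_p {j : ℕ} :
    mt m d (12 * m + 3 + d + 5 * j) = 12 * m + 3 + d + 5 * j + 2 := by
  unfold mt; split_ifs <;> omega

theorem mt_right_c {j : ℕ} :
    mt m d (12 * m + 3 + d + 5 * j + 3) = 12 * m + 3 + d + 5 * j + 4 := by
  unfold mt; split_ifs <;> first | omega | contradiction

/-- Every acquire `k` together with its release. -/
theorem mt_cases {k : ℕ} {l : Lck} (hk : k < 12 * m + 3 + d + 5 * m)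
    (h : (A.ev m d u v k).op = .acq l) :
    (k = 0 ∧ mt m d k = 7 ∧ l = A.p ∧ (A.ev m d u v k).thread = A.t₀) ∨
    (∃ i < m, k = 2 + 12 * i ∧ mt m d k = 2 + 12 * i + 11 ∧ l = A.c (u i) ∧
      (A.ev m d u v k).thread = A.t₁) ∨
    (∃ i < m, k = 2 + 12 * i + 6 ∧ (mt m d k = 2 + 12 * (i + 1) + 5 ∧ i + 1 < m ∨
      mt m d k = 12 * m + 2 ∧ i + 1 = m) ∧ l = A.p ∧ (A.ev m d u v k).thread = A.t₀) ∨
    (∃ i < m, (k = 2 + 12 * i + 1 ∨ k = 2 + 12 * i + 3 ∨ k = 2 + 12 * i + 7 ∨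
      k = 2 + 12 * i + 9) ∧ mt m d k = k + 1 ∧ l = A.y) ∨
    (∃ j < m, k = 12 * m + 3 + d + 5 * j ∧ mt m d k = k + 2 ∧ l = A.p) ∨
    (∃ j < m, k = 12 * m + 3 + d + 5 * j + 3 ∧ mt m d k = k + 1 ∧ l = A.c (v j)) := by
  rcases A.acq_cases hk h with ⟨rfl, rfl⟩ | ⟨i, hi, rfl, rfl⟩ | ⟨i, hi, rfl, rfl⟩ |
    ⟨i, hi, ho, rfl⟩ | ⟨j, hj, rfl, rfl⟩ | ⟨j, hj, rfl, rfl⟩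
  · exact Or.inl ⟨rfl, rfl, rfl, by rw [ev_zero]⟩
  · refine Or.inr (Or.inl ⟨i, hi, rfl, mt_c hi, rfl, ?_⟩)
    have := A.ev_left (d := d) (u := u) (v := v) hi (show 0 < 12 by omega)
    rw [add_zero] at this; rw [this]; rfl
  · refine Or.inr (Or.inr (Or.inl ⟨i, hi, rfl, ?_, rfl, ?_⟩))
    · rw [mt_p hi]; split_ifs <;> omega
    · rw [A.ev_left hi (by omega)]; rfl
  · refine Or.inr (Or.inr (Or.inr (Or.inl ⟨i, hi, ho, ?_, rfl⟩)))
    rcases ho with rfl | rfl | rfl | rfl <;> exact mt_y hi (by omega)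
  · exact Or.inr (Or.inr (Or.inr (Or.inr (Or.inl ⟨j, hj, rfl, mt_right_p, rfl⟩))))
  · exact Or.inr (Or.inr (Or.inr (Or.inr (Or.inr ⟨j, hj, rfl, mt_right_c, rfl⟩))))

theorem isMatching (hm : 0 < m) :
    IsMatching (12 * m + 3 + d + 5 * m) (A.ev m d u v) (mt m d) where
  lt a l ha h := by
    rcases A.mt_cases ha h with h | ⟨i, hi, h⟩ | ⟨i, hi, h⟩ | ⟨i, hi, h⟩ | ⟨j, hj, h⟩ |
      ⟨j, hj, h⟩ <;> omega
  eq a l ha h := by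
    rcases A.acq_cases ha h with ⟨rfl, rfl⟩ | ⟨i, hi, rfl, rfl⟩ | ⟨i, hi, rfl, rfl⟩ |
      ⟨i, hi, ho, rfl⟩ | ⟨j, hj, rfl, rfl⟩ | ⟨j, hj, rfl, rfl⟩
    -- The section over `p` opened at position `0` is closed inside block `0`, which exists since `m
    -- > 0`.
    · have : mt m d 0 = 2 + 12 * 0 + 5 := rfl
      rw [this, A.ev_left hm (by omega), ev_zero]; rfl
    · have := A.ev_left (d := d) (u := u) (v := v) hi (show 0 < 12 by omega)
      rw [add_zero] at this
      rw [this, mt_c hi, A.ev_left hi (by omega)]; rfl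
    · rw [A.ev_left hi (by omega), mt_p hi]
      split_ifs with h1
      · rw [ev_last]; rfl
      · rw [A.ev_left (by omega) (by omega)]; rfl
    · rcases ho with rfl | rfl | rfl | rfl <;>
        rw [mt_y hi (by omega), add_assoc _ _ 1, A.ev_left hi (by omega),
          A.ev_left hi (by omega)] <;> rfl
    · have := A.ev_right (m := m) (d := d) (u := u) (v := v) (j := j) (show 0 < 5 by omega)
      rw [add_zero] at this
      rw [this, mt_right_p, A.ev_right (by omega)]; rfl
    · rw [mt_right_c, A.ev_right (by omega), A.ev_right (by omega)]; rfl
  free a l k ha h hak hka := by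
    have hk : k < 12 * m + 3 + d + 5 * m := by
      rcases A.mt_cases ha h with h | ⟨i, hi, h⟩ | ⟨i, hi, h⟩ | ⟨i, hi, h⟩ | ⟨j, hj, h⟩ |
        ⟨j, hj, h⟩ <;> omega
    have e1 := A.py
    have e2 := A.pc
    have e3 := A.yc
    constructor
    · intro h'
      rcases A.mt_cases ha h with ⟨h1, h2, rfl, -⟩ | ⟨i, hi, h1, h2, rfl, -⟩ |
        ⟨i, hi, h1, h2, rfl, -⟩ | ⟨i, hi, h1, h2, rfl⟩ | ⟨j, hj, h1, h2, rfl⟩ |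
        ⟨j, hj, h1, h2, rfl⟩ <;>
      rcases A.acq_cases hk h' with ⟨g1, g2⟩ | ⟨i', hi', g1, g2⟩ | ⟨i', hi', g1, g2⟩ |
        ⟨i', hi', g1, g2⟩ | ⟨j', hj', g1, g2⟩ | ⟨j', hj', g1, g2⟩ <;>
      first
      | omega
      | exact e1 g2
      | exact e1 g2.symm
      | exact e2 _ g2
      | exact e2 _ g2.symm
      | exact e3 _ g2
      | exact e3 _ g2.symm
    · intro h'
      rcases A.mt_cases ha h with ⟨h1, h2, rfl, -⟩ | ⟨i, hi, h1, h2, rfl, -⟩ |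
        ⟨i, hi, h1, h2, rfl, -⟩ | ⟨i, hi, h1, h2, rfl⟩ | ⟨j, hj, h1, h2, rfl⟩ |
        ⟨j, hj, h1, h2, rfl⟩ <;>
      rcases A.rel_cases hk h' with ⟨g1, g2⟩ | ⟨i', hi', g1, g2⟩ | ⟨i', hi', g1, g2⟩ |
        ⟨i', hi', g1, g2⟩ | ⟨j', hj', g1, g2⟩ | ⟨j', hj', g1, g2⟩ <;>
      first
      | omega
      | exact e1 g2
      | exact e1 g2.symm
      | exact e2 _ g2
      | exact e2 _ g2.symm
      | exact e3 _ g2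
      | exact e3 _ g2.symm
  surj r l hr h := by
    rcases A.rel_cases hr h with ⟨rfl, rfl⟩ | ⟨i, hi, rfl, rfl⟩ | ⟨i, hi, rfl, rfl⟩ |
      ⟨i, hi, ho, rfl⟩ | ⟨j, hj, rfl, rfl⟩ | ⟨j, hj, rfl, rfl⟩
    · refine ⟨2 + 12 * (m - 1) + 6, by omega, ?_, ?_⟩
      · rw [A.ev_left (by omega) (by omega)]; rfl
      · rw [mt_p (by omega), if_pos (by omega)]
    · refine ⟨2 + 12 * i + 0, by omega, ?_, mt_c hi⟩
      rw [A.ev_left hi (by omega)]; rfl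
    · rcases i with _ | i
      · exact ⟨0, by omega, by rw [ev_zero], rfl⟩
      · refine ⟨2 + 12 * i + 6, by omega, ?_, ?_⟩
        · rw [A.ev_left (by omega) (by omega)]; rfl
        · rw [mt_p (by omega), if_neg (by omega)]
    · rcases ho with rfl | rfl | rfl | rfl
      · exact ⟨2 + 12 * i + 1, by omega, by rw [A.ev_left hi (by omega)]; rfl, mt_y hi (by omega)⟩
      · exact ⟨2 + 12 * i + 3, by omega, by rw [A.ev_left hi (by omega)]; rfl, mt_y hi (by omega)⟩
      · exact ⟨2 + 12 * i + 7, by omega, by rw [A.ev_left hi (by omega)]; rfl, mt_y hi (by omega)⟩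
      · exact ⟨2 + 12 * i + 9, by omega, by rw [A.ev_left hi (by omega)]; rfl, mt_y hi (by omega)⟩
    · refine ⟨12 * m + 3 + d + 5 * j + 0, by omega, ?_, mt_right_p⟩
      rw [A.ev_right (by omega)]; rfl
    · refine ⟨12 * m + 3 + d + 5 * j + 3, by omega, ?_, mt_right_c⟩
      rw [A.ev_right (by omega)]; rfl
  nested c a l l' hca hac hc ha hcN haN ht := by
    have e := A.t₀₁
    rcases A.mt_cases hcN hc with ⟨h1, h2, rfl, h3⟩ | ⟨i, hi, h1, h2, rfl, h3⟩ |
        ⟨i, hi, h1, h2, rfl, h3⟩ | ⟨i, hi, h1, h2, rfl⟩ | ⟨j, hj, h1, h2, rfl⟩ |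
        ⟨j, hj, h1, h2, rfl⟩ <;>
      rcases A.mt_cases haN ha with ⟨g1, g2, rfl, g3⟩ | ⟨i', hi', g1, g2, rfl, g3⟩ |
        ⟨i', hi', g1, g2, rfl, g3⟩ | ⟨i', hi', g1, g2, rfl⟩ | ⟨j', hj', g1, g2, rfl⟩ |
        ⟨j', hj', g1, g2, rfl⟩ <;>
      first
      | omega
      | (rw [g3, h3] at ht; exact absurd ht e)
      | (rw [g3, h3] at ht; exact absurd ht.symm e)

/-- The writes of `x`. -/
theorem write_cases {k : ℕ} {x : Var} (hk : k < 12 * m + 3 + d + 5 * m)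
    (h : (A.ev m d u v k).op = .write x) :
    x = A.x ∧ (k = 1 ∧ (A.ev m d u v k).thread = A.t₀ ∨
      ∃ j < m, k = 12 * m + 3 + d + 5 * j + 1 ∧ (A.ev m d u v k).thread = A.t₂) := by
  rcases position_cases hk with rfl | rfl | ⟨i, o, hi, ho, rfl⟩ | rfl | hk | ⟨j, o, hj, ho, rfl⟩
  · rw [ev_zero] at h; simp at h
  · rw [ev_one] at h ⊢; simp at h; simp [h]
  · rw [ev_left A hi ho] at h
    interval_cases o <;> simp [leftBlock] at h
  · rw [ev_last] at h; simp at h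
  · rw [ev_pad A hk.1 hk.2] at h; simp at h
  · rw [ev_right A ho] at h ⊢
    interval_cases o <;> simp [rightBlock] at h
    exact ⟨h.symm, Or.inr ⟨j, hj, rfl, rfl⟩⟩

/-- The reads are irrelevant. -/
theorem read_cases {k : ℕ} {x : Var} (hk : k < 12 * m + 3 + d + 5 * m)
    (h : (A.ev m d u v k).op = .read x) : x = A.z := by
  rcases position_cases hk with rfl | rfl | ⟨i, o, hi, ho, rfl⟩ | rfl | hk | ⟨j, o, hj, ho, rfl⟩
  · rw [ev_zero] at h; simp at h
  · rw [ev_one] at h; simp at h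
  · rw [ev_left A hi ho] at h
    interval_cases o <;> simp [leftBlock] at h
  · rw [ev_last] at h; simp at h
  · rw [ev_pad A hk.1 hk.2] at h; simpa [eq_comm] using h
  · rw [ev_right A ho] at h
    interval_cases o <;> simp [rightBlock] at h

theorem bound_right {j o : ℕ} (ho : o < 5) :
    bound m d u v (12 * m + 3 + d + 5 * j + o) =
      if o = 4 ∧ u (greedy u v j) = v j then 12 * greedy u v j + 14 else 12 * greedy u v j + 8 := by
  have h1 : (12 * m + 3 + d + 5 * j + o - (12 * m + 3 + d)) / 5 = j := by omega
  have h2 : (12 * m + 3 + d + 5 * j + o - (12 * m + 3 + d)) % 5 = o := by omega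
  rw [bound, if_neg (by omega)]
  simp only [h1, h2]

theorem bound_succ_le (k : ℕ) : bound m d u v k ≤ bound m d u v (k + 1) := by
  by_cases hk : k < 12 * m + 3 + d
  · rw [bound, if_pos hk]; exact Nat.zero_le _
  · obtain ⟨j, o, ho, rfl⟩ : ∃ j o, o < 5 ∧ k = 12 * m + 3 + d + 5 * j + o :=
      ⟨(k - (12 * m + 3 + d)) / 5, (k - (12 * m + 3 + d)) % 5, by omega, by omega⟩
    by_cases h4 : o = 4
    · subst h4
      have e : 12 * m + 3 + d + 5 * j + 4 + 1 = 12 * m + 3 + d + 5 * (j + 1) + 0 := by ring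
      rw [e, bound_right (by omega), bound_right (by omega), greedy]
      -- At the end of a block with a match the count `g` grows by one, and `12 * g + 14 ≤ 12 * (g +
      -- 1) + 8`; without a match the bound stays.
      by_cases hc : u (greedy u v j) = v j
      · simp only [hc, and_self, if_true]
        split_ifs <;> omega
      · simp [hc]
    · rw [add_assoc _ o 1, bound_right ho, bound_right (by omega), if_neg fun h => h4 h.1]
      split_ifs <;> omega

/-- With `g` the greedy count, `12 * g + 8` is one more than the position of the release of `p` in
left block `g`, and `12 * g + 14` one more than that of the release of `c (u g)`. Each value thus
lies just after a release, and any section over the lock in question that opens below the bound also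
closes below it. -/
theorem lt_bound_of_prec (hm : 0 < m)
    {i j : Fin (ofSeq (12 * m + 3 + d + 5 * m) (A.ev m d u v)).length} (h : Prec _ i j) :
    i.val < bound m d u v j := by
  refine (A.isMatching hm).lt_of_prec (bound m d u v)
    (fun i j hij _ => monotone_nat_of_le_succ bound_succ_le hij) ?_ ?_ h
  · intro a l x e e' ha hacq heN hlt hae hem he he' hw ht
    have he'N : e' < 12 * m + 3 + d + 5 * m := by omega
    have hx : x = A.x := by
      rcases hw with hw | hw
      · exact (A.write_cases heN hw).1
      · exact (A.write_cases he'N hw).1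
    subst hx
    have hwe := he.resolve_left fun h => A.xz (A.read_cases heN h)
    have hwe' := he'.resolve_left fun h => A.xz (A.read_cases he'N h)
    rcases (A.write_cases heN hwe).2 with ⟨h1, h2⟩ | ⟨j, hj, h1, h2⟩ <;>
      rcases (A.write_cases he'N hwe').2 with ⟨g1, g2⟩ | ⟨j', hj', g1, g2⟩
    · exact absurd (h2.trans g2.symm) ht
    · omega
    -- The only possible conflict is between the write at position `1` and a write in the right
    -- half, and the only section containing position `1` is the first one over `p`.
    · have ha0 : a = 0 ∧ mt m d a = 7 := by
        rcases A.mt_cases ha hacq with h | ⟨i, hi, h⟩ | ⟨i, hi, h⟩ | ⟨i, hi, h⟩ | ⟨j, hj, h⟩ |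
          ⟨j, hj, h⟩ <;> omega
      rw [ha0.2, h1, bound_right (by omega)]
      simp
    · exact absurd (h2.trans g2.symm) ht
  · intro a r l ha hr hacq hrel hlt
    by_cases hrR : r < 12 * m + 3 + d
    · rw [bound, if_pos hrR] at hlt; omega
    rcases A.rel_cases hr hrel with ⟨g1, rfl⟩ | ⟨i, hi, g1, rfl⟩ | ⟨i, hi, g1, rfl⟩ |
      ⟨i, hi, g1, rfl⟩ | ⟨j, hj, rfl, rfl⟩ | ⟨j, hj, rfl, rfl⟩
    · omega
    · omega
    · omega
    · omega
    · have hg := greedy_le u v j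
      rw [bound_right (by omega), if_neg (by omega)] at hlt ⊢
      rcases A.mt_cases ha hacq with ⟨h1, h2, h3, -⟩ | ⟨i, hi, h1, h2, h3, -⟩ |
        ⟨i, hi, h1, h2, h3, -⟩ | ⟨i, hi, h1, h2, h3⟩ | ⟨j, hj, h1, h2, h3⟩ |
        ⟨j, hj, h1, h2, h3⟩ <;> first | omega | exact absurd h3 (A.pc _)
    · have hg := greedy_le u v j
      rw [bound_right (by omega)] at hlt ⊢
      rcases A.mt_cases ha hacq with ⟨h1, h2, h3, -⟩ | ⟨i, hi, h1, h2, h3, -⟩ |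
        ⟨i, hi, h1, h2, h3, -⟩ | ⟨i, hi, h1, h2, h3⟩ | ⟨j, hj, h1, h2, h3⟩ |
        ⟨j, hj, h1, h2, h3⟩
      · exact absurd h3.symm (A.pc _)
      · have h4 := A.c_inj h3
        split_ifs at hlt ⊢ with h5
        · omega
        -- This is where a mismatch blocks progress: the section over a `c`-lock in block `greedy u
        -- v j` uses the other lock, so the relevant sections lie in earlier blocks.
        · have : i ≠ greedy u v j := by
            rintro rfl
            exact h5 ⟨rfl, h4.symm⟩
          omega
      · exact absurd h3.symm (A.pc _)
      · exact absurd h3.symm (A.yc _)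
      · split_ifs at hlt <;> omega
      · split_ifs at hlt <;> omega

/-- The relay through `y`: thread order up to a release of `y`, lock order to its next acquire by
the other thread, thread order from there on. -/
theorem hb_left (N : ℕ) {a b : ℕ} (hb : b + 3 < N) (hab : a < b)
    (h₁ : (A.ev m d u v a).thread = (A.ev m d u v b).thread)
    (h₂ : (A.ev m d u v b).op = .rel A.y) (h₃ : (A.ev m d u v (b + 1)).op = .acq A.y)
    (h₄ : (A.ev m d u v (b + 1)).thread = (A.ev m d u v (b + 3)).thread) :
    HBPos N (A.ev m d u v) a (b + 3) :=
  ((HBPos.thread (by omega) hab.le h₁).trans (HBPos.lock (by omega) (by omega) h₂ h₃)).trans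
    (HBPos.thread hb (by omega) h₄)

theorem prec_of_eq (huv : ∀ i < m, u i = v i) {j : ℕ} (hj : j < m) :
    PrecPos (12 * m + 3 + d + 5 * m) (A.ev m d u v) (2 + 12 * j + 11)
      (12 * m + 3 + d + 5 * j + 4) := by
  have hM := A.isMatching (d := d) (u := u) (v := v) (show 0 < m by omega)
  -- From the releases of `p` in blocks `i` to those of `c (u i) = c (v i)`; the equality of the
  -- bits makes rule (b) applicable.
  have key : ∀ i < m, PrecPos (12 * m + 3 + d + 5 * m) (A.ev m d u v) (2 + 12 * i + 5)
      (12 * m + 3 + d + 5 * i + 2) → PrecPos (12 * m + 3 + d + 5 * m) (A.ev m d u v)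
      (2 + 12 * i + 11) (12 * m + 3 + d + 5 * i + 4) := by
    intro i hi h
    have h1 : HBPos (12 * m + 3 + d + 5 * m) (A.ev m d u v) (2 + 12 * i + 0) (2 + 12 * i + 5) := by
      apply A.hb_left (b := 2 + 12 * i + 2) _ (by omega) (by omega)
      · rw [A.ev_left hi (by omega), A.ev_left hi (by omega)]; rfl
      · rw [A.ev_left hi (by omega)]; rfl
      · rw [add_assoc _ 2 1, A.ev_left hi (by omega)]; rfl
      · rw [add_assoc _ 2 1, add_assoc _ 2 3, A.ev_left hi (by omega), A.ev_left hi (by omega)]; rfl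
    have h2 : HBPos (12 * m + 3 + d + 5 * m) (A.ev m d u v) (12 * m + 3 + d + 5 * i + 2)
        (12 * m + 3 + d + 5 * i + 4) := by
      apply HBPos.thread (by omega) (by omega)
      rw [A.ev_right (by omega), A.ev_right (by omega)]; rfl
    have h3 := (h1.prec h).hb h2
    rw [← mt_right_c] at h3
    have h4 := hM.release (l := A.c (u i)) (by rw [A.ev_left hi (by omega)]; rfl)
      (by rw [A.ev_right (by omega), huv i hi]; rfl) (by rw [add_zero, mt_c hi]; omega)
      (by omega) h3
    rwa [mt_right_c, add_zero, mt_c hi] at h4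
  apply key j hj
  induction j with
  | zero =>
    have h1 := hM.conflict (a₁ := 0) (a₂ := 12 * m + 3 + d + 5 * 0 + 0) (e₁ := 1)
      (e₂ := 12 * m + 3 + d + 5 * 0 + 1) (l := A.p) (x := A.x) (by rw [ev_zero])
      (by rw [A.ev_right (by omega)]; rfl) (by simp only [mt, if_true]; omega) (by omega)
      (by simp [mt]) (by rw [ev_zero, ev_one]) (by omega) (by rw [add_zero, mt_right_p]; omega)
      (by rw [A.ev_right (by omega), A.ev_right (by omega)]; rfl) (by omega) (by rw [ev_one])
      (by rw [A.ev_right (by omega)]; rfl)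
      (by rw [A.ev_right (by omega), ev_one]; exact A.t₀₂.symm)
    refine h1.hb (HBPos.thread (by omega) (by omega) ?_)
    rw [A.ev_right (by omega), A.ev_right (by omega)]; rfl
  | succ i ih =>
    have hi : i < m := by omega
    have h := key i hi (ih hi)
    -- The section over `p` opened at offset `6` of block `i` ends in block `i + 1`. Its acquire
    -- reaches the release of `c (u i)` through `y`, so rule (b) over `p` carries the order to the
    -- next block.
    have h1 : HBPos (12 * m + 3 + d + 5 * m) (A.ev m d u v) (2 + 12 * i + 6)
        (2 + 12 * i + 11) := by
      apply A.hb_left (b := 2 + 12 * i + 8) _ (by omega) (by omega)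
      · rw [A.ev_left hi (by omega), A.ev_left hi (by omega)]; rfl
      · rw [A.ev_left hi (by omega)]; rfl
      · rw [add_assoc _ 8 1, A.ev_left hi (by omega)]; rfl
      · rw [add_assoc _ 8 1, add_assoc _ 8 3, A.ev_left hi (by omega), A.ev_left hi (by omega)]; rfl
    have h2 : HBPos (12 * m + 3 + d + 5 * m) (A.ev m d u v) (12 * m + 3 + d + 5 * i + 4)
        (12 * m + 3 + d + 5 * (i + 1) + 2) := by
      apply HBPos.thread (by omega) (by omega)
      rw [A.ev_right (by omega), A.ev_right (by omega)]; rfl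
    have h3 := (h1.prec h).hb h2
    rw [← mt_right_p] at h3
    have h4 := hM.release (l := A.p) (by rw [A.ev_left hi (by omega)]; rfl)
      (by rw [← add_zero (_ + 5 * (i + 1)), A.ev_right (by omega)]; rfl)
      (by rw [mt_p hi, if_neg (by omega)]; omega) (by omega) h3
    rwa [mt_right_p, mt_p hi, if_neg (by omega)] at h4

/-- The trace consists of two parts, encoding `u` and `v`, such that it depends on the equality
of `u` and `v` whether two particular events are ordered. -/
theorem wcp_iff (hm : 0 < m) (h₁ : 12 * m + 1 < 12 * m + 3 + d + 5 * m)
    (h₂ : 12 * m + 3 + d + 5 * m - 1 < 12 * m + 3 + d + 5 * m) :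
    WCP (ofSeq _ (A.ev m d u v)) (pos (12 * m + 1) h₁) (pos _ h₂) ↔ ∀ i < m, u i = v i := by
  have e₁ : 12 * m + 1 = 2 + 12 * (m - 1) + 11 := by omega
  have e₂ : 12 * m + 3 + d + 5 * m - 1 = 12 * m + 3 + d + 5 * (m - 1) + 4 := by omega
  constructor
  · rintro (h | h | h)
    · have h := A.lt_bound_of_prec hm h
      simp only [pos] at h
      rw [e₂, bound_right (by omega)] at h
      have hg := greedy_le u v (m - 1)
      split_ifs at h with hc
      -- Here `12 * m + 1 < 12 * g + 14` forces `g = m - 1`, and the last bit matches as well, so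
      -- the greedy count reaches `m`. Without that match, `12 * m + 1 < 12 * g + 8` would
      -- contradict `g ≤ m - 1`.
      · apply eq_of_greedy_eq
        obtain ⟨n, rfl⟩ : ∃ n, m = n + 1 := ⟨m - 1, by omega⟩
        simp only [Nat.add_sub_cancel] at *
        rw [greedy, if_pos hc.2]
        omega
      · omega
    · have h := h.2
      rw [thr_ofSeq, thr_ofSeq] at h
      simp only [pos] at h
      rw [e₂, e₁, A.ev_left (by omega) (by omega), A.ev_right (by omega)] at h
      exact absurd h A.t₁₂
    · have := congrArg Fin.val h
      simp only [pos] at this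
      omega
  · intro h
    obtain ⟨i₁, i₂, hp⟩ := A.prec_of_eq (d := d) h (show m - 1 < m by omega)
    left
    convert hp using 1 <;> exact Fin.ext (by simp only [pos]; omega)

end Palette

end Trace

/-! ### From traces to inputs, and the choice of parameters -/

namespace Trace

namespace Palette

variable {Thr Lck Var : Type*} (A : Palette Thr Lck Var)

theorem exists_palette [Fintype Thr] [Fintype Lck] [Fintype Var]
    (hThr : 3 ≤ Fintype.card Thr) (hLck : 4 ≤ Fintype.card Lck) (hVar : 2 ≤ Fintype.card Var) :
    Nonempty (Palette Thr Lck Var) := by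
  obtain ⟨t⟩ := Function.Embedding.nonempty_of_card_le (α := Fin 3) (β := Thr) (by simpa)
  obtain ⟨l⟩ := Function.Embedding.nonempty_of_card_le (α := Fin 4) (β := Lck) (by simpa)
  obtain ⟨x⟩ := Function.Embedding.nonempty_of_card_le (α := Fin 2) (β := Var) (by simpa)
  exact ⟨{
    t₀ := t 0, t₁ := t 1, t₂ := t 2, p := l 0, y := l 1
    c := fun b => if b then l 2 else l 3
    x := x 0, z := x 1
    t₀₁ := by simp
    t₀₂ := by simp
    t₁₂ := by simp
    py := by simp
    pc := fun b => by cases b <;> simp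
    yc := fun b => by cases b <;> simp
    c_inj := fun a b h => by cases a <;> cases b <;> simp_all
    xz := by simp }⟩

theorem ev_congr_left {m d k : ℕ} {u v v' : ℕ → Bool} (hk : k < 12 * m + 3) :
    A.ev m d u v k = A.ev m d u v' k := by
  simp only [ev, if_pos hk]

theorem ev_congr_right {m d k : ℕ} {u u' v : ℕ → Bool} (hk : 12 * m + 3 + d ≤ k) :
    A.ev m d u v k = A.ev m d u' v k := by
  rw [ev, ev, if_neg (by omega), if_neg (by omega), if_neg (by omega)]

end Palette

section Input

variable {Thr Lck Var α : Type*} (enc : Event Thr Lck Var × Bool × Bool → List α)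

theorem input_ofSeq (N : ℕ) (ev : ℕ → Event Thr Lck Var) {i j : ℕ} (hi : i < N) (hj : j < N) :
    input enc (ofSeq N ev) (pos i hi) (pos j hj) =
      (List.range N).flatMap fun k => enc (ev k, decide (k = i), decide (k = j)) := by
  have h : query (ofSeq N ev) (pos i hi) (pos j hj) =
      (List.range N).map fun k => (ev k, decide (k = i), decide (k = j)) := by
    apply List.ext_getElem
    · simp [query, length_ofSeq]
    · intro k h₁ h₂
      simp only [query, List.getElem_ofFn, get_ofSeq, List.getElem_map, List.getElem_range, pos,
        Fin.ext_iff]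
  rw [input, h, List.flatMap_map]

theorem range_append_append (a b c : ℕ) : List.range (a + b + c) =
    List.range a ++ ((List.range b).map (a + ·) ++ (List.range c).map (a + b + ·)) := by
  rw [List.range_add, List.range_add, List.append_assoc]

theorem length_le_length_flatMap {β : Type*} (f : β → List α) (hf : ∀ b, f b ≠ [])
    (l : List β) : l.length ≤ (l.flatMap f).length := by
  induction l with
  | nil => simp
  | cons b l ih =>
    have := List.length_pos_of_ne_nil (hf b)
    simp only [List.flatMap_cons, List.length_append, List.length_cons]
    omega

/-- The inputs that ask for the order of two particular events of the traces encoding two bit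
strings have a left part depending on the first one, a long fixed middle part, and a right part
depending on the second one. -/
theorem exists_input_split (henc : ∀ e, enc e ≠ []) (A : Palette Thr Lck Var) (m d : ℕ) {i j : ℕ}
    (hi : i < 12 * m + 3 + d + 5 * m) (hj : j < 12 * m + 3 + d + 5 * m) :
    ∃ (X Y : (ℕ → Bool) → List α) (P : List α), d ≤ P.length ∧ ∀ u v,
      input enc (ofSeq _ (A.ev m d u v)) (pos i hi) (pos j hj) = X u ++ (P ++ Y v) := by
  let w : (ℕ → Bool) → (ℕ → Bool) → ℕ → List α := fun u v k =>
    enc (A.ev m d u v k, decide (k = i), decide (k = j))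
  -- A dummy for the string on which a part does not depend. The marks are no obstacle, since the
  -- queried positions are fixed.
  let o : ℕ → Bool := fun _ => false
  refine ⟨fun u => (List.range (12 * m + 3)).flatMap (w u o),
    fun v => ((List.range (5 * m)).map (12 * m + 3 + d + ·)).flatMap (w o v),
    ((List.range d).map (12 * m + 3 + ·)).flatMap (w o o), ?_, fun u v => ?_⟩
  · have := length_le_length_flatMap (w o o) (fun _ => henc _)
      ((List.range d).map (12 * m + 3 + ·))
    simpa using this
  · rw [input_ofSeq, range_append_append, List.flatMap_append, List.flatMap_append]
    congr 1
    · refine List.flatMap_congr fun k hk => ?_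
      simp only [w, A.ev_congr_left (List.mem_range.1 hk) (v := v) (v' := o)]
    · congr 1
      · refine List.flatMap_congr fun k hk => ?_
        obtain ⟨k', hk', rfl⟩ := List.mem_map.1 hk
        rw [List.mem_range] at hk'
        simp only [w]
        rw [A.ev_pad (by omega) (by omega), A.ev_pad (by omega) (by omega)]
      · refine List.flatMap_congr fun k hk => ?_
        obtain ⟨k', hk', rfl⟩ := List.mem_map.1 hk
        simp only [w]
        rw [A.ev_congr_right (u' := o) (by omega)]

/-- The trade-off for the traces encoding two strings of `m` bits each. -/
theorem exists_mul_le_of_computesWCP (henc : ∀ e, enc e ≠ []) (A : Palette Thr Lck Var)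
    (M : OfflineTM.Machine α) (hM : ComputesWCP enc M) (T S : ℕ → ℕ) (hT : RunsInTime enc M T)
    (hS : RunsInSpace enc M S) : ∃ C : ℕ, ∀ m d N, 0 < m → N = 12 * m + 3 + d + 5 * m →
      m * d ≤ C * (T N * S N) := by
  obtain ⟨C, hC⟩ := OfflineTM.exists_mul_le_of_fooling M
  refine ⟨C, fun m d N hm hN => ?_⟩
  subst hN
  have h₁ : 12 * m + 1 < 12 * m + 3 + d + 5 * m := by omega
  have h₂ : 12 * m + 3 + d + 5 * m - 1 < 12 * m + 3 + d + 5 * m := by omega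
  obtain ⟨X, Y, P, hP, hXY⟩ := exists_input_split enc henc A m d h₁ h₂
  let ext : (Fin m → Bool) → ℕ → Bool := fun u k => if h : k < m then u ⟨k, h⟩ else false
  have htr : ∀ u v, IsTrace (ofSeq (12 * m + 3 + d + 5 * m) (A.ev m d u v)) := fun u v =>
    (A.isMatching hm).isTrace
  refine (Nat.mul_le_mul_left m hP).trans (hC m (fun u => X (ext u)) (fun u => Y (ext u)) P _ _
    (fun u => ?_) (fun u t => ?_) (fun u => ?_) fun u v h => ?_)
  · have := hT _ (htr (ext u) (ext u)) (pos _ h₁) (pos _ h₂)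
    rwa [hXY, length_ofSeq] at this
  · have := hS _ (htr (ext u) (ext u)) (pos _ h₁) (pos _ h₂) t
    rwa [hXY, length_ofSeq] at this
  · rw [← hXY, (hM _ (htr _ _) _ _).2, A.wcp_iff hm]
    exact fun _ _ => rfl
  · rw [← hXY, (hM _ (htr _ _) _ _).2, A.wcp_iff hm] at h
    funext k
    simpa [ext] using h k k.isLt

end Input

end Trace

theorem theorem5 {Thr Lck Var α : Type*} [Fintype Thr] [Fintype Lck] [Fintype Var] [Fintype α]
    (hThr : 3 ≤ Fintype.card Thr) (hLck : 4 ≤ Fintype.card Lck) (hVar : 2 ≤ Fintype.card Var)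
    (enc : Trace.Event Thr Lck Var × Bool × Bool → List α) (henc : ∀ e, enc e ≠ [])
    (M : OfflineTM.Machine α) (hM : Trace.ComputesWCP enc M)
    (T S : ℕ → ℕ) (hT : Trace.RunsInTime enc M T) (hS : Trace.RunsInSpace enc M S) :
    (fun n : ℕ => (n : ℝ) ^ 2) =O[Filter.atTop] fun n : ℕ => (T n : ℝ) * (S n : ℝ) := by
  obtain ⟨A⟩ := Trace.Palette.exists_palette hThr hLck hVar
  obtain ⟨C, hC⟩ := Trace.exists_mul_le_of_computesWCP enc henc A M hM T S hT hS
  refine Asymptotics.IsBigO.of_bound (6400 * C) ?_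
  filter_upwards [Filter.eventually_ge_atTop 40] with n hn
  -- A bit costs `12 + 5 = 17` events, so `m = n / 40` leaves more than half of a long trace for the
  -- padding. For `n ≥ 40` both `m` and `d` are at least `n / 80`, whence `6400 = 80 ^ 2`.
  have h1 := hC (n / 40) (n - 3 - 17 * (n / 40)) n (by omega) (by omega)
  have h2 : n ≤ 80 * (n / 40) := by omega
  have h3 : n ≤ 80 * (n - 3 - 17 * (n / 40)) := by omega
  have h4 : n ^ 2 ≤ 6400 * C * (T n * S n) := by
    calc n ^ 2 = n * n := sq n
      _ ≤ 80 * (n / 40) * (80 * (n - 3 - 17 * (n / 40))) := Nat.mul_le_mul h2 h3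
      _ = 6400 * (n / 40 * (n - 3 - 17 * (n / 40))) := by ring
      _ ≤ 6400 * (C * (T n * S n)) := Nat.mul_le_mul_left _ h1
      _ = _ := by ring
  rw [Real.norm_of_nonneg (by positivity), Real.norm_of_nonneg (by positivity)]
  exact_mod_cast h4
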